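/- Every rational number $x\in[0,1]$ has a unique finite odd continued fraction $$x=1+\cfrac{\varepsilon_1}{a_1+\cfrac{\varepsilon_2}{a_2+\ldots+\cfrac{\varepsilon_l}{a_l}}},$$ where $l\ge 0$, the $a_j$ are odd positive integers, $\varepsilon_j=\pm1$, $\varepsilon_1=-1$, $a_j+\varepsilon_{j+1}\ge 2$ for $1\le j<l$, and $\varepsilon_l=1$ if $l\ge2$ and $a_l=1$ (the case $l=0$ is $x=1$). Put $S(x)=\sum_{j=1}^{l}a_j$, $\mathcal M_n=\{x\in\mathbb Q\cap[0,1]: S(x)\le n+1\}$, and $$F_n(x)=\frac{\#\{\xi\in\mathcal M_n:\xi\le x\}}{\#\mathcal M_n},\qquad F(x)=\lim_{n\to\infty}F_n(x).$$ Theorem 3. The limit $F(x)$ exists for every $x\in[0,1]$. If at a point $x\in[0,1]$ the derivative $F'(x)$ exists, finite or infinite (one-sided if $x=0$ or $x=1$), then $F'(x)=0$ or $F'(x)=+\infty$. Consequently $F$ is a singular function on $[0,1]$: it is monotone, continuous and not constant, and $F'(x)=0$ for almost every $x\in[0,1]$ with respect to Lebesgue measure. -/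

import Mathlib

open Set Filter Topology MeasureTheory

/-- The value `ε₁ / (a₁ + ε₂ / (a₂ + … + ε_l / a_l))` of a finite list of pairs `(ε_j, a_j)`;
the empty list has the value `0`. -/
def oddTail : List (ℤ × ℕ) → ℚ
  | [] => 0
  | t :: l => (t.1 : ℚ) / ((t.2 : ℚ) + oddTail l)

/-- The value `[1; ε₁/a₁, …, ε_l/a_l] = 1 + ε₁ / (a₁ + ε₂ / (a₂ + … + ε_l / a_l))`. -/
def oddValue (l : List (ℤ × ℕ)) : ℚ := 1 + oddTail l

/-- The list of pairs `(ε_j, a_j)` is the list of a (finite) odd continued fraction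
`[1; ε₁/a₁, …, ε_l/a_l]`. The last clause makes the representation of a rational number unique;
it concerns fractions with at least two partial quotients, since `0 = [1; -1/1]`
has no other representation. (The empty list represents `1`.) -/
structure IsOddCF (l : List (ℤ × ℕ)) : Prop where
  /-- `ε_j = ±1` -/
  sign : ∀ t ∈ l, t.1 = 1 ∨ t.1 = -1
  /-- every `a_j` is odd -/
  odd : ∀ t ∈ l, Odd t.2
  /-- `ε₁ = -1` -/
  head : ∀ t ∈ l.head?, t.1 = -1
  /-- `a_j + ε_{j+1} ≥ 2` -/
  chain : l.IsChain (fun s t => 2 ≤ (s.2 : ℤ) + t.1)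
  /-- if the last partial quotient is `1`, then its numerator is `1` -/
  last : 2 ≤ l.length → ∀ t ∈ l.getLast?, t.2 = 1 → t.1 = 1

/-- The sum `a₁ + … + a_l` of the partial quotients. -/
def oddSum (l : List (ℤ × ℕ)) : ℕ := (l.map Prod.snd).sum

/-- The set `M_n` of the rational numbers in `[0,1]` whose odd continued fraction has sum of
partial quotients at most `n + 1`. -/
def oddM (n : ℕ) : Set ℚ :=
  {x | 0 ≤ x ∧ x ≤ 1 ∧ ∃ l, IsOddCF l ∧ oddValue l = x ∧ oddSum l ≤ n + 1}

/-- The distribution function `F_n` of the set `M_n`. -/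
noncomputable def oddDistrib (n : ℕ) (x : ℝ) : ℝ :=
  ({ξ : ℚ | ξ ∈ oddM n ∧ (ξ : ℝ) ≤ x}.ncard : ℝ) / ((oddM n).ncard : ℝ)

/-- The limit distribution function `F` of the sets `M_n`. -/
noncomputable def oddF (x : ℝ) : ℝ := limUnder atTop (fun n : ℕ => oddDistrib n x)

/-- `f` has at `x`, relative to `s`, the finite or infinite derivative `d`. -/
def HasExtDerivWithinAt (f : ℝ → ℝ) (d : EReal) (s : Set ℝ) (x : ℝ) : Prop :=
  Tendsto (fun y => ((slope f x y : ℝ) : EReal)) (𝓝[s \ {x}] x) (𝓝 d)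

/-- `f` is a singular function on `[a, b]`: monotone, continuous, not constant, with derivative
`0` almost everywhere. -/
structure IsSingularOn (f : ℝ → ℝ) (a b : ℝ) : Prop where
  monotone : MonotoneOn f (Icc a b)
  continuous : ContinuousOn f (Icc a b)
  lt : f a < f b
  deriv : ∀ᵐ x ∂(volume.restrict (Icc a b)), HasDerivWithinAt f 0 (Icc a b) x

/-! Write `x = 1 - 1 / y` with `y = a₁ + ε₂ / (a₂ + …)`. Every odd continued fraction other than
that of `1` arises from a shorter one by exchanging `y` for `1 + 1 / y`, `3 - 1 / y` or `y + 2`,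
which adds 1, 3 or 2 to the sum of the partial quotients. On `[0, 1]` these substitutions are
`leftMap`, `midMap`, `rightMap`, whose images tile `[0, 1]` and meet only at `1/2` and `2/3`. Hence
`oddM (n + 3)` is glued from copies of `oddM (n + 2)`, `oddM n`, `oddM (n + 1)` (`oddM_add_three`).
Only sets of values are counted, so uniqueness of the expansion plays no role.

With `z + z² + z³ = 1`, the numbers `z ^ n * #oddM n` tend to a positive limit, and the counts up to
`x`, scaled in the same way, are uniformly Cauchy because the recursion contracts their differences.
Thus `F` exists, and passing to the limit makes it self-similar: the three pieces carry the masses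
`z`, `z³`, `z²`.

Iterating the branches puts `x` in nested intervals with endpoints `a / s`, `b / t`, length `1 / (s
t)` and mass `|β|`. A finite derivative `d` at `x` forces `|β| s t → |d|`. If `d ≠ 0`, consecutive
slopes have quotient close to 1, which confines `s / t` to neighbourhoods of two numbers; but the
subdivision then moves `s / t` out of these neighbourhoods, so two successive steps contradict each
other (`Cylinder.IsChild.isBalanced`). Hence `d = 0`. Monotonicity excludes `-∞`, Lebesgue's theorem
gives derivative zero almost everywhere, and density of the range gives continuity. -/

/-- The decreasing Möbius map of `[0, 1]` onto `[0, 1/2]` induced by `y ↦ 1 + 1 / y`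
under `x = 1 - 1 / y`. -/
def leftMap {K : Type*} [Field K] (x : K) : K := (1 - x) / (2 - x)

/-- The increasing Möbius map of `[0, 1]` onto `[1/2, 2/3]` induced by `y ↦ 3 - 1 / y`
under `x = 1 - 1 / y`. -/
def midMap {K : Type*} [Field K] (x : K) : K := (1 + x) / (2 + x)

/-- The increasing Möbius map of `[0, 1]` onto `[2/3, 1]` induced by `y ↦ y + 2`
under `x = 1 - 1 / y`. -/
def rightMap {K : Type*} [Field K] (x : K) : K := (2 - x) / (3 - 2 * x)

/-! ### Order and images of the three branches -/

section Maps

theorem cast_leftMap (x : ℚ) : ((leftMap x : ℚ) : ℝ) = leftMap (x : ℝ) := by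
  simp [leftMap]

theorem cast_midMap (x : ℚ) : ((midMap x : ℚ) : ℝ) = midMap (x : ℝ) := by
  simp [midMap]

theorem cast_rightMap (x : ℚ) : ((rightMap x : ℚ) : ℝ) = rightMap (x : ℝ) := by
  simp [rightMap]

variable {K : Type*} [Field K] [LinearOrder K] [IsStrictOrderedRing K] {x y : K}

theorem leftMap_le_leftMap (hx : x ≤ 1) (hy : y ≤ 1) : leftMap x ≤ leftMap y ↔ y ≤ x := by
  unfold leftMap
  rw [div_le_div_iff₀ (by linarith) (by linarith)]
  constructor <;> intro h <;> nlinarith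

theorem midMap_le_midMap (hx : 0 ≤ x) (hy : 0 ≤ y) : midMap x ≤ midMap y ↔ x ≤ y := by
  unfold midMap
  rw [div_le_div_iff₀ (by linarith) (by linarith)]
  constructor <;> intro h <;> nlinarith

theorem rightMap_le_rightMap (hx : x ≤ 1) (hy : y ≤ 1) : rightMap x ≤ rightMap y ↔ x ≤ y := by
  unfold rightMap
  rw [div_le_div_iff₀ (by linarith) (by linarith)]
  constructor <;> intro h <;> nlinarith

theorem leftMap_mem (hx : x ∈ Icc 0 1) : leftMap x ∈ Icc 0 (1 / 2) := by
  obtain ⟨h0, h1⟩ := hx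
  unfold leftMap
  refine ⟨div_nonneg (by linarith) (by linarith), ?_⟩
  rw [div_le_div_iff₀ (by linarith) (by norm_num)]
  linarith

theorem midMap_mem (hx : x ∈ Icc 0 1) : midMap x ∈ Icc (1 / 2) (2 / 3) := by
  obtain ⟨h0, h1⟩ := hx
  unfold midMap
  rw [mem_Icc, div_le_div_iff₀ (by norm_num) (by linarith),
    div_le_div_iff₀ (by linarith) (by norm_num)]
  constructor <;> linarith

theorem rightMap_mem (hx : x ∈ Icc 0 1) : rightMap x ∈ Icc (2 / 3) 1 := by
  obtain ⟨h0, h1⟩ := hx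
  unfold rightMap
  rw [mem_Icc, div_le_div_iff₀ (by norm_num) (by linarith), div_le_one (by linarith)]
  constructor <;> linarith

theorem leftMap_zero : leftMap (0 : K) = 1 / 2 := by norm_num [leftMap]

theorem leftMap_one : leftMap (1 : K) = 0 := by norm_num [leftMap]

theorem midMap_zero : midMap (0 : K) = 1 / 2 := by norm_num [midMap]

theorem midMap_one : midMap (1 : K) = 2 / 3 := by norm_num [midMap]

theorem rightMap_zero : rightMap (0 : K) = 2 / 3 := by norm_num [rightMap]

theorem rightMap_one : rightMap (1 : K) = 1 := by norm_num [rightMap]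

theorem exists_leftMap_eq (h0 : 0 ≤ x) (h1 : x ≤ 1 / 2) : ∃ y ∈ Icc (0 : K) 1, leftMap y = x := by
  have h : 0 < 1 - x := by linarith
  refine ⟨(1 - 2 * x) / (1 - x), ⟨div_nonneg (by linarith) h.le, ?_⟩, ?_⟩
  · rw [div_le_one h]; linarith
  · have h2 : 2 - (1 - 2 * x) / (1 - x) = 1 / (1 - x) := by field_simp; ring
    rw [leftMap, h2]; field_simp; ring

theorem exists_midMap_eq (h0 : 1 / 2 ≤ x) (h1 : x ≤ 2 / 3) :
    ∃ y ∈ Icc (0 : K) 1, midMap y = x := by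
  have h : 0 < 1 - x := by linarith
  refine ⟨(2 * x - 1) / (1 - x), ⟨div_nonneg (by linarith) h.le, ?_⟩, ?_⟩
  · rw [div_le_one h]; linarith
  · have h2 : 2 + (2 * x - 1) / (1 - x) = 1 / (1 - x) := by field_simp; ring
    rw [midMap, h2]; field_simp; ring

theorem exists_rightMap_eq (h0 : 2 / 3 ≤ x) (h1 : x ≤ 1) :
    ∃ y ∈ Icc (0 : K) 1, rightMap y = x := by
  have h : 0 < 2 * x - 1 := by linarith
  refine ⟨(3 * x - 2) / (2 * x - 1), ⟨div_nonneg (by linarith) h.le, ?_⟩, ?_⟩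
  · rw [div_le_one h]; linarith
  · have h2 : 3 - 2 * ((3 * x - 2) / (2 * x - 1)) = 1 / (2 * x - 1) := by field_simp; ring
    rw [rightMap, h2]; field_simp; ring

theorem exists_eq_map_of_mem (hx : x ∈ Icc 0 1) :
    ∃ y ∈ Icc (0 : K) 1, x = leftMap y ∨ x = midMap y ∨ x = rightMap y := by
  rcases le_total x (1 / 2) with h | h
  · obtain ⟨y, hy, e⟩ := exists_leftMap_eq hx.1 h
    exact ⟨y, hy, .inl e.symm⟩
  rcases le_total x (2 / 3) with h' | h'
  · obtain ⟨y, hy, e⟩ := exists_midMap_eq h h'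
    exact ⟨y, hy, .inr (.inl e.symm)⟩
  · obtain ⟨y, hy, e⟩ := exists_rightMap_eq h' hx.2
    exact ⟨y, hy, .inr (.inr e.symm)⟩

end Maps

/-! ### Bounds for odd continued fractions -/

/-- By induction the fraction following `a` has absolute value at most 1. If its sign is positive it
only helps; if it is negative, the chain condition gives `a ≥ 3`, so at least 2 remains. -/
theorem one_le_add_oddTail {t : ℤ × ℕ} {l : List (ℤ × ℕ)}
    (hs : ∀ s ∈ t :: l, s.1 = 1 ∨ s.1 = -1) (ho : ∀ s ∈ t :: l, Odd s.2)
    (hc : (t :: l).IsChain (fun s t => 2 ≤ (s.2 : ℤ) + t.1)) :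
    1 ≤ (t.2 : ℚ) + oddTail l := by
  induction l generalizing t with
  | nil =>
    have := (ho t (by simp)).pos
    simp only [oddTail, add_zero]
    exact_mod_cast this
  | cons u r ih =>
    have h1 : 1 ≤ (u.2 : ℚ) + oddTail r :=
      ih (fun s h => hs s (List.mem_cons_of_mem _ h)) (fun s h => ho s (List.mem_cons_of_mem _ h))
        hc.tail
    have h2 : (2 : ℚ) ≤ (t.2 : ℚ) + u.1 := by
      have := (List.isChain_cons_cons.1 hc).1
      exact_mod_cast this
    have h3 : (1 : ℚ) ≤ t.2 := by exact_mod_cast (ho t (by simp)).pos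
    have h4 : 1 / ((u.2 : ℚ) + oddTail r) ≤ 1 := by rw [div_le_one (by linarith)]; exact h1
    have h5 : 0 < 1 / ((u.2 : ℚ) + oddTail r) := by positivity
    simp only [oddTail]
    rcases hs u (by simp) with h | h <;> rw [h] at h2 ⊢
    · push_cast at *; linarith
    · push_cast at *; rw [neg_div]; linarith

theorem IsOddCF.one_le {t : ℤ × ℕ} {l : List (ℤ × ℕ)} (h : IsOddCF (t :: l)) :
    1 ≤ (t.2 : ℚ) + oddTail l :=
  one_le_add_oddTail h.sign h.odd h.chain

theorem IsOddCF.oddValue_cons {t : ℤ × ℕ} {l : List (ℤ × ℕ)} (h : IsOddCF (t :: l)) :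
    oddValue (t :: l) = 1 - 1 / ((t.2 : ℚ) + oddTail l) := by
  have : t.1 = -1 := h.head t (by simp)
  simp only [oddValue, oddTail, this]
  push_cast
  ring

theorem isOddCF_nil : IsOddCF [] := ⟨by simp, by simp, by simp, by simp, by simp⟩

theorem IsOddCF.mem_Icc {l : List (ℤ × ℕ)} (h : IsOddCF l) : oddValue l ∈ Icc (0 : ℚ) 1 := by
  cases l with
  | nil => simp [oddValue, oddTail]
  | cons t l =>
    rw [h.oddValue_cons]
    have h1 := h.one_le
    have h4 : 1 / ((t.2 : ℚ) + oddTail l) ≤ 1 := by rw [div_le_one (by linarith)]; exact h1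
    have h5 : 0 < 1 / ((t.2 : ℚ) + oddTail l) := by positivity
    constructor <;> linarith

/-- The length proviso of `last` disappears: once a head is present, the clause binds exactly when
the tail is nonempty. -/
theorem isOddCF_cons_iff {ε : ℤ} {a : ℕ} {l : List (ℤ × ℕ)} :
    IsOddCF ((ε, a) :: l) ↔ ε = -1 ∧ Odd a ∧ (∀ t ∈ l, t.1 = 1 ∨ t.1 = -1) ∧
      (∀ t ∈ l, Odd t.2) ∧ (∀ t ∈ l.head?, 2 ≤ (a : ℤ) + t.1) ∧
      l.IsChain (fun s t => 2 ≤ (s.2 : ℤ) + t.1) ∧ (∀ t ∈ l.getLast?, t.2 = 1 → t.1 = 1) := by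
  constructor
  · intro h
    refine ⟨h.head (ε, a) (by simp), h.odd (ε, a) (by simp),
      fun t ht => h.sign t (by simp [ht]), fun t ht => h.odd t (by simp [ht]), ?_, h.chain.tail, ?_⟩
    · cases l with
      | nil => simp
      | cons u r => simpa using (List.isChain_cons_cons.1 h.chain).1
    · cases l with
      | nil => simp
      | cons u r => simpa [List.getLast?_cons_cons] using h.last (by simp)
  · rintro ⟨rfl, ha, hs, ho, hh, hc, hl⟩
    refine ⟨?_, ?_, by simp, ?_, ?_⟩
    · simpa using hs
    · simp only [List.mem_cons, forall_eq_or_imp]; exact ⟨ha, ho⟩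
    · cases l with
      | nil => simp
      | cons u r => exact List.isChain_cons_cons.2 ⟨by simpa using hh, hc⟩
    · cases l with
      | nil => simp
      | cons u r => intro _; simpa [List.getLast?_cons_cons] using hl

/-! ### The recursion for the sets `oddM n` -/

/-- The rational numbers with an odd continued fraction of sum at most `m`. -/
def oddLevel (m : ℕ) : Set ℚ := {x | ∃ l, IsOddCF l ∧ oddValue l = x ∧ oddSum l ≤ m}

theorem oddM_eq_oddLevel (n : ℕ) : oddM n = oddLevel (n + 1) := by
  ext x
  constructor
  · rintro ⟨_, _, h⟩; exact h
  · rintro ⟨l, h, rfl, hs⟩; exact ⟨h.mem_Icc.1, h.mem_Icc.2, l, h, rfl, hs⟩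

theorem one_mem_oddLevel (m : ℕ) : 1 ∈ oddLevel m :=
  ⟨[], isOddCF_nil, by simp [oddValue, oddTail], by simp [oddSum]⟩

theorem isOddCF_singleton {a : ℕ} (h : Odd a) : IsOddCF [(-1, a)] :=
  isOddCF_cons_iff.2 ⟨rfl, h, by simp, by simp, by simp, by simp, by simp⟩

theorem zero_mem_oddLevel (m : ℕ) : 0 ∈ oddLevel (m + 1) :=
  ⟨[(-1, 1)], isOddCF_singleton odd_one, by simp [oddValue, oddTail], by simp [oddSum]⟩

theorem leftMap_mem_oddLevel {m : ℕ} {x : ℚ} (hx : x ∈ oddLevel m) :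
    leftMap x ∈ oddLevel (m + 1) := by
  obtain ⟨l, h, rfl, hs⟩ := hx
  cases l with
  | nil =>
    convert zero_mem_oddLevel m
    norm_num [leftMap, oddValue, oddTail]
  | cons t r =>
    obtain ⟨ε, a⟩ := t
    have h' := isOddCF_cons_iff.1 h
    obtain ⟨rfl, ha, h1, h2, h3, h4, h5⟩ := h'
    have key : IsOddCF ((-1, 1) :: (1, a) :: r) := by
      refine isOddCF_cons_iff.2 ⟨rfl, odd_one, by simpa using h1, ?_, by simp, ?_, ?_⟩
      · simp only [List.mem_cons, forall_eq_or_imp]; exact ⟨ha, h2⟩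
      · cases r with
        | nil => simp
        | cons u r => exact List.isChain_cons_cons.2 ⟨by simpa using h3, h4⟩
      · cases r with
        | nil => simp
        | cons u r => simpa [List.getLast?_cons_cons] using h5
    refine ⟨_, key, ?_, ?_⟩
    · have := h.one_le
      rw [key.oddValue_cons, h.oddValue_cons, leftMap]
      simp only [oddTail] at this ⊢
      push_cast
      have h0 : (0 : ℚ) < a + oddTail r := by linarith
      generalize (a : ℚ) + oddTail r = Y at *
      have e1 : 2 - (1 - 1 / Y) = (Y + 1) / Y := by field_simp; ring
      have e2 : 1 + 1 / Y = (Y + 1) / Y := by field_simp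
      rw [e1, e2]
      field_simp
      ring
    · simp only [oddSum, List.map_cons, List.sum_cons] at hs ⊢; omega

theorem rightMap_mem_oddLevel {m : ℕ} {x : ℚ} (hx : x ∈ oddLevel m) :
    rightMap x ∈ oddLevel (m + 2) := by
  obtain ⟨l, h, rfl, hs⟩ := hx
  cases l with
  | nil =>
    convert one_mem_oddLevel (m + 2)
    norm_num [rightMap, oddValue, oddTail]
  | cons t r =>
    obtain ⟨ε, a⟩ := t
    have h' := isOddCF_cons_iff.1 h
    obtain ⟨rfl, ha, h1, h2, h3, h4, h5⟩ := h'
    have key : IsOddCF ((-1, a + 2) :: r) := by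
      refine isOddCF_cons_iff.2 ⟨rfl, by grind, h1, h2, ?_, h4, h5⟩
      intro t ht
      have := h3 t ht
      push_cast
      omega
    refine ⟨_, key, ?_, ?_⟩
    · have := h.one_le
      rw [key.oddValue_cons, h.oddValue_cons, rightMap]
      simp only at this ⊢
      push_cast
      have h0 : (0 : ℚ) < a + oddTail r := by linarith
      rw [add_right_comm]
      generalize (a : ℚ) + oddTail r = Y at *
      have e1 : 3 - 2 * (1 - 1 / Y) = (Y + 2) / Y := by field_simp; ring
      rw [e1]
      field_simp
      ring
    · simp only [oddSum, List.map_cons, List.sum_cons] at hs ⊢; omega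

theorem midMap_mem_oddLevel {m : ℕ} {x : ℚ} (hx : x ∈ oddLevel m) :
    midMap x ∈ oddLevel (m + 3) := by
  obtain ⟨l, h, rfl, hs⟩ := hx
  cases l with
  | nil =>
    refine ⟨[(-1, 3)], isOddCF_singleton (by decide), ?_, ?_⟩
    · norm_num [midMap, oddValue, oddTail]
    · simp [oddSum]
  | cons t r =>
    obtain ⟨ε, a⟩ := t
    have h' := isOddCF_cons_iff.1 h
    obtain ⟨rfl, ha, h1, h2, h3, h4, h5⟩ := h'
    -- Prepending 3 to the expansion of `0` would end in `-1/1`, which `last` forbids; but `midMap 0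
    -- = leftMap 0 = 1/2`.
    by_cases hra : r = [] ∧ a = 1
    · obtain ⟨rfl, rfl⟩ := hra
      have h0 := leftMap_mem_oddLevel (zero_mem_oddLevel (m + 1))
      convert h0
      norm_num [midMap, leftMap, oddValue, oddTail]
    have key : IsOddCF ((-1, 3) :: (-1, a) :: r) := by
      refine isOddCF_cons_iff.2 ⟨rfl, by decide, by simpa using h1, ?_, by simp, ?_, ?_⟩
      · simp only [List.mem_cons, forall_eq_or_imp]; exact ⟨ha, h2⟩
      · exact h.chain
      · cases r with
        | nil => simpa using hra
        | cons u r => simpa [List.getLast?_cons_cons] using h5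
    refine ⟨_, key, ?_, ?_⟩
    · have := h.one_le
      rw [key.oddValue_cons, h.oddValue_cons, midMap]
      simp only [oddTail] at this ⊢
      push_cast
      have h0 : (0 : ℚ) < a + oddTail r := by linarith
      generalize (a : ℚ) + oddTail r = Y at *
      have e1 : 2 + (1 - 1 / Y) = (3 * Y - 1) / Y := by field_simp; ring
      have e2 : 3 + -1 / Y = (3 * Y - 1) / Y := by field_simp; ring
      have e3 : 3 * Y - 1 ≠ 0 := by linarith
      rw [e1, e2]
      field_simp
      ring
    · simp only [oddSum, List.map_cons, List.sum_cons] at hs ⊢; omega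

/-- The first step is read off from `a₁` and `ε₂`. If `a₁ = 1`, then `ε₂ = 1` or nothing follows,
and the step is `leftMap`. If `a₁ = 3` and `ε₂ = -1`, it is `midMap`. Otherwise `a₁` can be lowered
by 2 without violating the chain condition, and it is `rightMap`. -/
theorem eq_map_of_mem_oddLevel {m : ℕ} {x : ℚ} (hx : x ∈ oddLevel m) :
    x = 1 ∨ (∃ k y, k + 1 = m ∧ y ∈ oddLevel k ∧ leftMap y = x) ∨
      (∃ k y, k + 3 = m ∧ y ∈ oddLevel k ∧ midMap y = x) ∨
      (∃ k y, k + 2 = m ∧ y ∈ oddLevel k ∧ rightMap y = x) := by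
  obtain ⟨l, h, rfl, hs⟩ := hx
  cases l with
  | nil => left; simp [oddValue, oddTail]
  | cons t r =>
    right
    obtain ⟨ε, a⟩ := t
    obtain ⟨rfl, ha, h1, h2, h3, h4, h5⟩ := isOddCF_cons_iff.1 h
    have hY := h.one_le
    rw [h.oddValue_cons]
    simp only [oddSum, List.map_cons, List.sum_cons] at hs
    have right_case : (∀ t ∈ r.head?, 2 ≤ ((a - 2 : ℕ) : ℤ) + t.1) → 3 ≤ a →
        ∃ k y, k + 2 = m ∧ y ∈ oddLevel k ∧
          rightMap y = 1 - 1 / ((a : ℚ) + oddTail r) := by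
      intro hh ha3
      have key : IsOddCF ((-1, a - 2) :: r) :=
        isOddCF_cons_iff.2 ⟨rfl, by grind, h1, h2, hh, h4, h5⟩
      refine ⟨m - 2, _, by omega, ⟨_, key, rfl, ?_⟩, ?_⟩
      · simp only [oddSum, List.map_cons, List.sum_cons]; omega
      · have hY' := key.one_le
        rw [key.oddValue_cons, rightMap]
        simp only at hY' ⊢
        have e : (a : ℚ) + oddTail r = (((a - 2 : ℕ) : ℚ) + oddTail r) + 2 := by
          push_cast [Nat.cast_sub (show 2 ≤ a by omega)]; ring
        rw [e]
        generalize (((a - 2 : ℕ) : ℚ) + oddTail r) = Y at *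
        have e1 : 3 - 2 * (1 - 1 / Y) = (Y + 2) / Y := by field_simp; ring
        have : 0 < Y := by linarith
        rw [e1]
        field_simp
        ring
    rcases r with _ | ⟨⟨ε, b⟩, r⟩
    · rcases Nat.lt_or_ge a 3 with h' | h'
      · have : a = 1 := by grind
        subst this
        left
        exact ⟨m - 1, 1, by omega, one_mem_oddLevel _, by norm_num [leftMap, oddTail]⟩
      · right; right; exact right_case (by simp) h'
    -- Deleting the first partial quotient and resetting the next sign to `-1` leaves an admissible
    -- list; if only `b` remains, `last` asks nothing.
    · have hb : IsOddCF ((-1, b) :: r) := by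
        refine isOddCF_cons_iff.2 ⟨rfl, h2 (ε, b) (by simp), fun t ht => h1 t (by simp [ht]),
          fun t ht => h2 t (by simp [ht]), ?_, h4.tail, ?_⟩
        · cases r with
          | nil => simp
          | cons u r => simpa using (List.isChain_cons_cons.1 h4).1
        · cases r with
          | nil => simp
          | cons u r => simpa [List.getLast?_cons_cons] using h5
      have hbY := hb.one_le
      have hε : ε = 1 ∨ ε = -1 := h1 (ε, b) (by simp)
      have haε : 2 ≤ (a : ℤ) + ε := h3 (ε, b) (by simp)
      simp only [List.map_cons, List.sum_cons] at hs
      by_cases ha1 : a = 1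
      · subst ha1
        left
        have : ε = 1 := by omega
        subst this
        refine ⟨m - 1, _, by omega, ⟨_, hb, rfl, ?_⟩, ?_⟩
        · simp only [oddSum, List.map_cons, List.sum_cons]; omega
        · rw [hb.oddValue_cons, leftMap]
          simp only [oddTail] at hbY ⊢
          push_cast
          generalize (b : ℚ) + oddTail r = Y at *
          have : 0 < Y := by linarith
          have e1 : 2 - (1 - 1 / Y) = (Y + 1) / Y := by field_simp; ring
          have e2 : 1 + 1 / Y = (Y + 1) / Y := by field_simp
          rw [e1, e2]
          field_simp
          ring
      have ha3 : 3 ≤ a := by grind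
      by_cases hm : a = 3 ∧ ε = -1
      · obtain ⟨rfl, rfl⟩ := hm
        right; left
        refine ⟨m - 3, _, by omega, ⟨_, hb, rfl, ?_⟩, ?_⟩
        · simp only [oddSum, List.map_cons, List.sum_cons]; omega
        · rw [hb.oddValue_cons, midMap]
          simp only [oddTail] at hbY ⊢
          push_cast
          generalize (b : ℚ) + oddTail r = Y at *
          have : 0 < Y := by linarith
          have e1 : 2 + (1 - 1 / Y) = (3 * Y - 1) / Y := by field_simp; ring
          have e2 : 3 + -1 / Y = (3 * Y - 1) / Y := by field_simp; ring
          have e3 : 3 * Y - 1 ≠ 0 := by linarith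
          rw [e1, e2, one_div_div, div_div_eq_mul_div, eq_sub_iff_add_eq, ← add_div,
            div_eq_one_iff_eq e3]
          field_simp
          ring
      · right; right
        refine right_case ?_ ha3
        have : 2 ≤ ((a - 2 : ℕ) : ℤ) + ε := by
          have : a ≠ 4 := by rintro rfl; exact absurd ha (by decide)
          omega
        simpa using this

theorem finite_oddLevel (m : ℕ) : (oddLevel m).Finite := by
  induction m using Nat.strong_induction_on with
  | _ m ih =>
    have hU : ((⋃ k ∈ Iio m, oddLevel k)).Finite := (finite_Iio m).biUnion fun k hk => ih k hk
    refine ((finite_singleton (1 : ℚ)).union ((hU.image leftMap).union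
      ((hU.image midMap).union (hU.image rightMap)))).subset ?_
    intro x hx
    rcases eq_map_of_mem_oddLevel hx with h | ⟨k, y, hk, hy, h⟩ | ⟨k, y, hk, hy, h⟩ |
      ⟨k, y, hk, hy, h⟩
    · exact .inl h
    all_goals have hy' : y ∈ ⋃ k ∈ Iio m, oddLevel k := mem_biUnion (show k < m by omega) hy
    · exact .inr (.inl ⟨y, hy', h⟩)
    · exact .inr (.inr (.inl ⟨y, hy', h⟩))
    · exact .inr (.inr (.inr ⟨y, hy', h⟩))

theorem finite_oddM (n : ℕ) : (oddM n).Finite := oddM_eq_oddLevel n ▸ finite_oddLevel _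

theorem oddM_subset_Icc (n : ℕ) : oddM n ⊆ Icc 0 1 := fun _ h => ⟨h.1, h.2.1⟩

theorem zero_mem_oddM (n : ℕ) : 0 ∈ oddM n := oddM_eq_oddLevel n ▸ zero_mem_oddLevel n

theorem one_mem_oddM (n : ℕ) : 1 ∈ oddM n := oddM_eq_oddLevel n ▸ one_mem_oddLevel (n + 1)

/-- The shift by 3 keeps every level on the right nonzero, so that each contains both `0` and `1`
and neighbouring pieces share their common endpoint. -/
theorem oddM_add_three (n : ℕ) :
    oddM (n + 3) = leftMap '' oddM (n + 2) ∪ midMap '' oddM n ∪ rightMap '' oddM (n + 1) := by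
  simp only [oddM_eq_oddLevel]
  ext x
  constructor
  · intro hx
    rcases eq_map_of_mem_oddLevel hx with h | ⟨k, y, hk, hy, h⟩ | ⟨k, y, hk, hy, h⟩ |
      ⟨k, y, hk, hy, h⟩
    · exact .inr ⟨1, one_mem_oddLevel _, by rw [rightMap_one, h]⟩
    · obtain rfl : k = n + 2 + 1 := by omega
      exact .inl (.inl ⟨y, hy, h⟩)
    · obtain rfl : k = n + 1 := by omega
      exact .inl (.inr ⟨y, hy, h⟩)
    · obtain rfl : k = n + 1 + 1 := by omega
      exact .inr ⟨y, hy, h⟩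
  · rintro ((⟨y, hy, rfl⟩ | ⟨y, hy, rfl⟩) | ⟨y, hy, rfl⟩)
    · exact leftMap_mem_oddLevel hy
    · exact midMap_mem_oddLevel hy
    · exact rightMap_mem_oddLevel hy

/-! ### Counting the elements of `oddM n` up to `x` -/

theorem ncard_union_add_one {α : Type*} {S T : Set α} {p : α} (hS : S.Finite) (hT : T.Finite)
    (h : S ∩ T = {p}) : (S ∪ T).ncard + 1 = S.ncard + T.ncard := by
  rw [← ncard_union_add_ncard_inter S T hS hT, h, ncard_singleton]

theorem injOn_leftMap (n : ℕ) : InjOn leftMap (oddM n) := fun _ hx _ hy h =>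
  le_antisymm ((leftMap_le_leftMap hy.2.1 hx.2.1).1 h.symm.le)
    ((leftMap_le_leftMap hx.2.1 hy.2.1).1 h.le)

theorem injOn_midMap (n : ℕ) : InjOn midMap (oddM n) := fun _ hx _ hy h =>
  le_antisymm ((midMap_le_midMap hx.1 hy.1).1 h.le) ((midMap_le_midMap hy.1 hx.1).1 h.symm.le)

theorem injOn_rightMap (n : ℕ) : InjOn rightMap (oddM n) := fun _ hx _ hy h =>
  le_antisymm ((rightMap_le_rightMap hx.2.1 hy.2.1).1 h.le)
    ((rightMap_le_rightMap hy.2.1 hx.2.1).1 h.symm.le)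

/-- The elements of `oddM n` that are at most `x`. -/
def oddMLe (n : ℕ) (x : ℝ) : Set ℚ := {ξ | ξ ∈ oddM n ∧ (ξ : ℝ) ≤ x}

theorem oddMLe_subset (n : ℕ) (x : ℝ) : oddMLe n x ⊆ oddM n := fun _ h => h.1

theorem finite_oddMLe (n : ℕ) (x : ℝ) : (oddMLe n x).Finite :=
  (finite_oddM n).subset (oddMLe_subset n x)

theorem oddMLe_one (n : ℕ) : oddMLe n 1 = oddM n := by
  ext ξ
  refine ⟨fun h => h.1, fun h => ⟨h, ?_⟩⟩
  exact_mod_cast h.2.1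

theorem cast_mem_Icc {n : ℕ} {ξ : ℚ} (h : ξ ∈ oddM n) : (ξ : ℝ) ∈ Icc (0 : ℝ) 1 :=
  ⟨by exact_mod_cast h.1, by exact_mod_cast h.2.1⟩

theorem zero_mem_oddMLe (n : ℕ) {x : ℝ} (hx : 0 ≤ x) : 0 ∈ oddMLe n x :=
  ⟨zero_mem_oddM n, by simpa using hx⟩

theorem oddMLe_leftMap (n : ℕ) {x : ℝ} (hx : x ∈ Icc (0 : ℝ) 1) :
    oddMLe (n + 3) (leftMap x) = leftMap '' {ξ | ξ ∈ oddM (n + 2) ∧ x ≤ ξ} := by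
  ext ξ
  constructor
  · rintro ⟨h, hle⟩
    -- A point of the other two pieces can lie below `leftMap x ≤ 1/2` only if it equals `1/2 =
    -- leftMap 0`, and then `x = 0`.
    have half (h' : (1 / 2 : ℚ) ≤ ξ) : ξ ∈ leftMap '' {ξ | ξ ∈ oddM (n + 2) ∧ x ≤ ξ} := by
      have h1 : (1 / 2 : ℝ) ≤ ξ := by
        have : ((1 / 2 : ℚ) : ℝ) ≤ ξ := by exact_mod_cast h'
        simpa using this
      have h2 : (leftMap x : ℝ) ≤ 1 / 2 := (leftMap_mem hx).2
      refine ⟨0, ⟨zero_mem_oddM _, ?_⟩, ?_⟩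
      · have h3 : leftMap (0 : ℝ) ≤ leftMap x := by rw [leftMap_zero]; linarith
        simpa using (leftMap_le_leftMap zero_le_one hx.2).1 h3
      · have : (ξ : ℝ) = 1 / 2 := by linarith
        rw [leftMap_zero]
        have : (ξ : ℝ) = ((1 / 2 : ℚ) : ℝ) := by rw [this]; simp
        exact_mod_cast this.symm
    rw [oddM_add_three] at h
    rcases h with (⟨y, hy, rfl⟩ | ⟨y, hy, rfl⟩) | ⟨y, hy, rfl⟩
    · rw [cast_leftMap, leftMap_le_leftMap (cast_mem_Icc hy).2 hx.2] at hle
      exact ⟨y, ⟨hy, hle⟩, rfl⟩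
    · exact half (midMap_mem (oddM_subset_Icc _ hy)).1
    · exact half (le_trans (by norm_num) (rightMap_mem (oddM_subset_Icc _ hy)).1)
  · rintro ⟨y, ⟨hy, hxy⟩, rfl⟩
    refine ⟨?_, ?_⟩
    · rw [oddM_add_three]; exact .inl (.inl ⟨y, hy, rfl⟩)
    · rw [cast_leftMap, leftMap_le_leftMap (cast_mem_Icc hy).2 hx.2]
      exact hxy

theorem oddMLe_midMap (n : ℕ) {x : ℝ} (hx : x ∈ Icc (0 : ℝ) 1) :
    oddMLe (n + 3) (midMap x) = leftMap '' oddM (n + 2) ∪ midMap '' oddMLe n x := by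
  ext ξ
  constructor
  · rintro ⟨h, hle⟩
    rw [oddM_add_three] at h
    rcases h with (⟨y, hy, rfl⟩ | ⟨y, hy, rfl⟩) | ⟨y, hy, rfl⟩
    · exact .inl ⟨y, hy, rfl⟩
    · rw [cast_midMap, midMap_le_midMap (cast_mem_Icc hy).1 hx.1] at hle
      exact .inr ⟨y, ⟨hy, hle⟩, rfl⟩
    · right
      -- Here the point must be the contact point `2/3 = midMap 1`, with `x = 1`.
      have h1 : (2 / 3 : ℝ) ≤ (rightMap y : ℚ) := by
        rw [cast_rightMap]; exact (rightMap_mem (cast_mem_Icc hy)).1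
      have h2 : (midMap x : ℝ) ≤ 2 / 3 := (midMap_mem hx).2
      refine ⟨1, ⟨one_mem_oddM _, ?_⟩, ?_⟩
      · have h3 : midMap (1 : ℝ) ≤ midMap x := by rw [midMap_one]; linarith
        simpa using (midMap_le_midMap zero_le_one hx.1).1 h3
      · have h3 : ((rightMap y : ℚ) : ℝ) = ((2 / 3 : ℚ) : ℝ) := by push_cast; linarith
        rw [midMap_one]
        exact_mod_cast h3.symm
  · rintro (⟨y, hy, rfl⟩ | ⟨y, ⟨hy, hyx⟩, rfl⟩)
    · refine ⟨by rw [oddM_add_three]; exact .inl (.inl ⟨y, hy, rfl⟩), ?_⟩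
      rw [cast_leftMap]
      exact (leftMap_mem (cast_mem_Icc hy)).2.trans (midMap_mem hx).1
    · refine ⟨by rw [oddM_add_three]; exact .inl (.inr ⟨y, hy, rfl⟩), ?_⟩
      rwa [cast_midMap, midMap_le_midMap (cast_mem_Icc hy).1 hx.1]

theorem oddMLe_rightMap (n : ℕ) {x : ℝ} (hx : x ∈ Icc (0 : ℝ) 1) :
    oddMLe (n + 3) (rightMap x) =
      leftMap '' oddM (n + 2) ∪ midMap '' oddM n ∪ rightMap '' oddMLe (n + 1) x := by
  ext ξ
  constructor
  · rintro ⟨h, hle⟩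
    rw [oddM_add_three] at h
    rcases h with h | ⟨y, hy, rfl⟩
    · exact .inl h
    · rw [cast_rightMap, rightMap_le_rightMap (cast_mem_Icc hy).2 hx.2] at hle
      exact .inr ⟨y, ⟨hy, hle⟩, rfl⟩
  · rintro ((⟨y, hy, rfl⟩ | ⟨y, hy, rfl⟩) | ⟨y, ⟨hy, hyx⟩, rfl⟩)
    · refine ⟨by rw [oddM_add_three]; exact .inl (.inl ⟨y, hy, rfl⟩), ?_⟩
      rw [cast_leftMap]
      have := (leftMap_mem (cast_mem_Icc hy)).2
      have := (rightMap_mem hx).1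
      linarith
    · refine ⟨by rw [oddM_add_three]; exact .inl (.inr ⟨y, hy, rfl⟩), ?_⟩
      rw [cast_midMap]
      exact (midMap_mem (cast_mem_Icc hy)).2.trans (rightMap_mem hx).1
    · refine ⟨by rw [oddM_add_three]; exact .inr ⟨y, hy, rfl⟩, ?_⟩
      rwa [cast_rightMap, rightMap_le_rightMap (cast_mem_Icc hy).2 hx.2]

/-- `S` serves both for a whole level and for its part up to `x`; each contains `0`, the preimage of
the contact point. -/
theorem image_leftMap_inter_image_midMap {m n : ℕ} {S : Set ℚ} (hS : S ⊆ oddM n) (h0 : 0 ∈ S) :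
    leftMap '' oddM m ∩ midMap '' S = {1 / 2} := by
  refine subset_antisymm ?_ ?_
  · rintro _ ⟨⟨y, hy, rfl⟩, ⟨w, hw, h⟩⟩
    have h1 := (leftMap_mem (oddM_subset_Icc _ hy)).2
    have h2 := (midMap_mem (oddM_subset_Icc _ (hS hw))).1
    rw [h] at h2
    exact le_antisymm h1 h2
  · rintro _ rfl
    exact ⟨⟨0, zero_mem_oddM m, leftMap_zero⟩, ⟨0, h0, midMap_zero⟩⟩

theorem image_union_inter_image_rightMap {m n k : ℕ} {S : Set ℚ} (hS : S ⊆ oddM k) (h0 : 0 ∈ S) :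
    (leftMap '' oddM m ∪ midMap '' oddM n) ∩ rightMap '' S = {2 / 3} := by
  refine subset_antisymm ?_ ?_
  · rintro _ ⟨hy, ⟨w, hw, rfl⟩⟩
    have h2 := (rightMap_mem (oddM_subset_Icc _ (hS hw))).1
    refine le_antisymm ?_ h2
    rcases hy with ⟨y, hy, h⟩ | ⟨y, hy, h⟩ <;> rw [← h]
    · exact (leftMap_mem (oddM_subset_Icc _ hy)).2.trans (by norm_num)
    · exact (midMap_mem (oddM_subset_Icc _ hy)).2
  · rintro _ rfl
    exact ⟨.inr ⟨1, one_mem_oddM n, midMap_one⟩, ⟨0, h0, rightMap_zero⟩⟩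

/-- Since `leftMap` reverses order, the points up to `leftMap x` come from those at least `x`.
Together with the points at most `x` these cover the level, overlapping at most in `x` itself; hence
the slack of 1, which vanishes after scaling by `z ^ n`. -/
theorem ncard_oddMLe_leftMap (n : ℕ) {x : ℝ} (hx : x ∈ Icc (0 : ℝ) 1) :
    (oddM (n + 2)).ncard ≤ (oddMLe (n + 3) (leftMap x)).ncard + (oddMLe (n + 2) x).ncard ∧
    (oddMLe (n + 3) (leftMap x)).ncard + (oddMLe (n + 2) x).ncard ≤ (oddM (n + 2)).ncard + 1 := by
  set T : Set ℚ := {ξ | ξ ∈ oddM (n + 2) ∧ x ≤ ξ}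
  have hT : T ⊆ oddM (n + 2) := fun _ h => h.1
  have hTf := (finite_oddM (n + 2)).subset hT
  rw [oddMLe_leftMap n hx, ((injOn_leftMap _).mono hT).ncard_image]
  have hu : T ∪ oddMLe (n + 2) x = oddM (n + 2) := by
    refine subset_antisymm (union_subset hT (oddMLe_subset _ _)) fun ξ h => ?_
    rcases le_total x ξ with h' | h'
    exacts [.inl ⟨h, h'⟩, .inr ⟨h, h'⟩]
  have hi : (T ∩ oddMLe (n + 2) x).ncard ≤ 1 := by
    rw [ncard_le_one (hTf.subset inter_subset_left)]
    rintro a ⟨⟨_, h1⟩, ⟨_, h2⟩⟩ b ⟨⟨_, h3⟩, ⟨_, h4⟩⟩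
    have : (a : ℝ) = b := by linarith
    exact_mod_cast this
  have := ncard_union_add_ncard_inter T (oddMLe (n + 2) x) hTf (finite_oddMLe _ _)
  rw [hu] at this
  omega

theorem ncard_oddMLe_midMap (n : ℕ) {x : ℝ} (hx : x ∈ Icc (0 : ℝ) 1) :
    (oddMLe (n + 3) (midMap x)).ncard + 1 = (oddM (n + 2)).ncard + (oddMLe n x).ncard := by
  rw [oddMLe_midMap n hx, ncard_union_add_one ((finite_oddM _).image _)
    ((finite_oddMLe n x).image _)
    (image_leftMap_inter_image_midMap (oddMLe_subset n x) (zero_mem_oddMLe n hx.1)),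
    (injOn_leftMap _).ncard_image,
    ((injOn_midMap n).mono (oddMLe_subset n x)).ncard_image]

theorem ncard_oddMLe_rightMap (n : ℕ) {x : ℝ} (hx : x ∈ Icc (0 : ℝ) 1) :
    (oddMLe (n + 3) (rightMap x)).ncard + 2 =
      (oddM (n + 2)).ncard + (oddM n).ncard + (oddMLe (n + 1) x).ncard := by
  have h1 := ncard_union_add_one (((finite_oddM (n + 2)).image leftMap).union
    ((finite_oddM n).image midMap)) ((finite_oddMLe (n + 1) x).image rightMap)
    (image_union_inter_image_rightMap (oddMLe_subset (n + 1) x) (zero_mem_oddMLe _ hx.1))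
  have h2 := ncard_union_add_one ((finite_oddM (n + 2)).image leftMap)
    ((finite_oddM n).image midMap)
    (image_leftMap_inter_image_midMap subset_rfl (zero_mem_oddM n))
  rw [((injOn_rightMap _).mono (oddMLe_subset (n + 1) x)).ncard_image,
    ← oddMLe_rightMap n hx] at h1
  rw [(injOn_leftMap _).ncard_image, (injOn_midMap _).ncard_image] at h2
  omega

theorem ncard_oddM_add_three (n : ℕ) :
    (oddM (n + 3)).ncard + 2 = (oddM (n + 2)).ncard + (oddM n).ncard + (oddM (n + 1)).ncard := by
  have := ncard_oddMLe_rightMap n (x := 1) (by simp)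
  rwa [rightMap_one, oddMLe_one, oddMLe_one] at this

theorem two_le_ncard_oddM (n : ℕ) : 2 ≤ (oddM n).ncard := by
  rw [← ncard_pair (zero_ne_one (α := ℚ))]
  refine ncard_le_ncard ?_ (finite_oddM n)
  rintro _ (rfl | rfl)
  exacts [zero_mem_oddM n, one_mem_oddM n]

theorem pow_mul_ncard_oddMLe_midMap (z : ℝ) (n : ℕ) {x : ℝ} (hx : x ∈ Icc (0 : ℝ) 1) :
    z ^ (n + 3) * ((oddMLe (n + 3) (midMap x)).ncard : ℝ) =
      z * (z ^ (n + 2) * ((oddM (n + 2)).ncard : ℝ)) +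
        z ^ 3 * (z ^ n * ((oddMLe n x).ncard : ℝ)) - z ^ 3 * z ^ n := by
  have a : ((oddMLe (n + 3) (midMap x)).ncard : ℝ) + 1 =
    (oddM (n + 2)).ncard + (oddMLe n x).ncard := by exact_mod_cast ncard_oddMLe_midMap n hx
  rw [eq_sub_of_add_eq a]
  ring

theorem pow_mul_ncard_oddMLe_rightMap (z : ℝ) (n : ℕ) {x : ℝ} (hx : x ∈ Icc (0 : ℝ) 1) :
    z ^ (n + 3) * ((oddMLe (n + 3) (rightMap x)).ncard : ℝ) =
      z * (z ^ (n + 2) * ((oddM (n + 2)).ncard : ℝ)) +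
        z ^ 3 * (z ^ n * ((oddM n).ncard : ℝ)) +
        z ^ 2 * (z ^ (n + 1) * ((oddMLe (n + 1) x).ncard : ℝ)) - z ^ 3 * (2 * z ^ n) := by
  have a : ((oddMLe (n + 3) (rightMap x)).ncard : ℝ) + 2 =
    (oddM (n + 2)).ncard + (oddM n).ncard + (oddMLe (n + 1) x).ncard := by
    exact_mod_cast ncard_oddMLe_rightMap n hx
  rw [eq_sub_of_add_eq a]
  ring

/-! ### Asymptotics of the counts -/

/-- `z` is the real root of `z + z ^ 2 + z ^ 3 = 1` (the inverse of the tribonacci constant),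
located with some precision. -/
structure IsTribonacciRoot (z : ℝ) : Prop where
  eq_one : z + z ^ 2 + z ^ 3 = 1
  lower : 0.5436 < z
  upper : z < 0.5437

theorem exists_isTribonacciRoot : ∃ z, IsTribonacciRoot z := by
  have hc : ContinuousOn (fun z : ℝ => z + z ^ 2 + z ^ 3) (Icc 0.5436 0.5437) := by fun_prop
  obtain ⟨z, hz, h⟩ := intermediate_value_Ioo (by norm_num) hc
    (show (1 : ℝ) ∈ Ioo _ _ by constructor <;> norm_num)
  exact ⟨z, h, hz.1, hz.2⟩

namespace IsTribonacciRoot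

variable {z : ℝ} (hz : IsTribonacciRoot z)
include hz

theorem pos : 0 < z := lt_trans (by norm_num) hz.lower

theorem lt_one : z < 1 := hz.upper.trans (by norm_num)

/-- A sequence satisfying the averaging recursion with the weights `z`, `z ^ 2`, `z ^ 3`
converges. -/
theorem exists_tendsto_of_recurrence {u : ℕ → ℝ}
    (hu : ∀ n, u (n + 3) = z * u (n + 2) + z ^ 2 * u (n + 1) + z ^ 3 * u n) :
    ∃ c, Tendsto u atTop (𝓝 c) := by
  have h0 := hz.pos
  have hz1 := hz.upper
  have h2 : z ^ 2 ≤ 0.3 := by nlinarith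
  have h3 : z ^ 3 ≤ 0.17 := by nlinarith [pow_pos h0 2]
  have h4 := hz.eq_one
  set C := max |u 1 - u 0| (|u 2 - u 1| / 0.8)
  have key : ∀ n, |u (n + 1) - u n| ≤ C * 0.8 ^ n ∧ |u (n + 2) - u (n + 1)| ≤ C * 0.8 ^ (n + 1) := by
    intro n
    induction n with
    | zero =>
      refine ⟨by rw [pow_zero, mul_one]; exact le_max_left _ _, ?_⟩
      rw [zero_add, pow_one, ← div_le_iff₀ (by norm_num)]
      exact le_max_right _ _
    | succ n ih =>
      refine ⟨ih.2, ?_⟩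
      -- As the weights sum to 1, the recursion factors through the differences, which obey a
      -- contracting recursion of order two.
      have e : u (n + 1 + 2) - u (n + 1 + 1) =
          -(z ^ 2 + z ^ 3) * (u (n + 2) - u (n + 1)) - z ^ 3 * (u (n + 1) - u n) := by
        rw [show n + 1 + 2 = n + 3 from rfl, hu]
        linear_combination u (n + 2) * h4
      have hp : 0 < z ^ 3 := by positivity
      have hC : 0 ≤ C * 0.8 ^ n := (abs_nonneg _).trans ih.1
      calc |u (n + 1 + 2) - u (n + 1 + 1)|
          ≤ (z ^ 2 + z ^ 3) * |u (n + 2) - u (n + 1)| + z ^ 3 * |u (n + 1) - u n| := by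
            rw [e]
            rw [sub_eq_add_neg]
            refine (abs_add_le _ _).trans ?_
            rw [abs_neg, abs_mul, abs_mul, abs_neg, abs_of_pos hp,
              abs_of_pos (show 0 < z ^ 2 + z ^ 3 by positivity)]
        _ ≤ (0.3 + 0.17) * (C * 0.8 ^ (n + 1)) + 0.17 * (C * 0.8 ^ n) := by
            gcongr
            exacts [ih.2, ih.1]
        -- `0.47 * 0.8 + 0.17 = 0.546`, which is below `0.8 ^ 2 = 0.64`.
        _ ≤ C * 0.8 ^ (n + 1 + 1) := by
            simp only [pow_succ]
            generalize (0.8 : ℝ) ^ n = q at hC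
            nlinarith
  refine cauchySeq_tendsto_of_complete (cauchySeq_of_le_geometric 0.8 C (by norm_num) fun n => ?_)
  rw [dist_comm, Real.dist_eq]
  exact (key n).1

theorem exists_tendsto_ncard :
    ∃ c, 0 < c ∧ Tendsto (fun n => z ^ n * ((oddM n).ncard : ℝ)) atTop (𝓝 c) := by
  have h0 := hz.pos
  have h4 := hz.eq_one
  -- Subtracting 1 absorbs the two shared endpoints and makes the recursion homogeneous.
  set u : ℕ → ℝ := fun n => z ^ n * ((oddM n).ncard - 1)
  have hu : ∀ n, u (n + 3) = z * u (n + 2) + z ^ 2 * u (n + 1) + z ^ 3 * u n := by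
    intro n
    have h : ((oddM (n + 3)).ncard : ℝ) + 2 =
        (oddM (n + 2)).ncard + (oddM n).ncard + (oddM (n + 1)).ncard := by
      exact_mod_cast ncard_oddM_add_three n
    have h' : ((oddM (n + 3)).ncard : ℝ) =
        (oddM (n + 2)).ncard + (oddM n).ncard + (oddM (n + 1)).ncard - 2 := by linarith
    simp only [u, h']
    ring
  obtain ⟨c, hc⟩ := hz.exists_tendsto_of_recurrence hu
  have hk : ∀ n, (1 : ℝ) ≤ (oddM n).ncard - 1 := by
    intro n
    have : (2 : ℝ) ≤ (oddM n).ncard := by exact_mod_cast two_le_ncard_oddM n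
    linarith
  have h1 := hz.lt_one
  -- A weighted average of terms at least `z ^ 2` is at least `z ^ 2`; this makes the limit
  -- positive.
  have hl : ∀ n, z ^ 2 ≤ u n ∧ z ^ 2 ≤ u (n + 1) ∧ z ^ 2 ≤ u (n + 2) := by
    intro n
    induction n with
    | zero =>
      have base (i : ℕ) (hi : i ≤ 2) : z ^ 2 ≤ u i := by
        have := pow_le_pow_of_le_one h0.le h1.le hi
        have := hk i
        have : 0 < z ^ i := by positivity
        simp only [u]
        nlinarith
      exact ⟨base 0 (by norm_num), base 1 (by norm_num), base 2 le_rfl⟩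
    | succ n ih =>
      refine ⟨ih.2.1, ih.2.2, ?_⟩
      rw [show n + 1 + 2 = n + 3 from rfl, hu]
      calc z ^ 2 = z * z ^ 2 + z ^ 2 * z ^ 2 + z ^ 3 * z ^ 2 := by
            rw [← add_mul, ← add_mul, h4, one_mul]
        _ ≤ _ := by gcongr; exacts [ih.2.2, ih.2.1, ih.1]
  refine ⟨c, lt_of_lt_of_le (pow_pos h0 2) (ge_of_tendsto' hc fun n => (hl n).1), ?_⟩
  have := hc.add (tendsto_pow_atTop_nhds_zero_of_lt_one h0.le h1)
  rw [add_zero] at this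
  refine this.congr fun n => ?_
  simp only [u]
  ring

theorem abs_pow_mul_ncard_oddMLe_leftMap_sub_le (n : ℕ) {x : ℝ} (hx : x ∈ Icc (0 : ℝ) 1) :
    |z ^ (n + 3) * ((oddMLe (n + 3) (leftMap x)).ncard : ℝ) -
      z * (z ^ (n + 2) * ((oddM (n + 2)).ncard : ℝ) -
        z ^ (n + 2) * ((oddMLe (n + 2) x).ncard : ℝ))| ≤ z ^ n := by
  have h0 := hz.pos
  have h1 := hz.lt_one
  obtain ⟨a1, a2⟩ := ncard_oddMLe_leftMap n hx
  have b1 : ((oddM (n + 2)).ncard : ℝ) ≤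
    (oddMLe (n + 3) (leftMap x)).ncard + (oddMLe (n + 2) x).ncard := by exact_mod_cast a1
  have b2 : ((oddMLe (n + 3) (leftMap x)).ncard : ℝ) + (oddMLe (n + 2) x).ncard ≤
    (oddM (n + 2)).ncard + 1 := by exact_mod_cast a2
  rw [show z ^ (n + 3) * ((oddMLe (n + 3) (leftMap x)).ncard : ℝ) -
      z * (z ^ (n + 2) * ((oddM (n + 2)).ncard : ℝ) -
        z ^ (n + 2) * ((oddMLe (n + 2) x).ncard : ℝ)) = z ^ (n + 3) *
      ((oddMLe (n + 3) (leftMap x)).ncard + (oddMLe (n + 2) x).ncard - (oddM (n + 2)).ncard) by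
    ring, abs_mul, abs_of_pos (by positivity : 0 < z ^ (n + 3))]
  have h3 : z ^ (n + 3) ≤ z ^ n := pow_le_pow_of_le_one h0.le h1.le (by omega)
  have h4 : |((oddMLe (n + 3) (leftMap x)).ncard : ℝ) + (oddMLe (n + 2) x).ncard -
      (oddM (n + 2)).ncard| ≤ 1 := by rw [abs_le]; constructor <;> linarith
  calc _ ≤ z ^ n * 1 := by gcongr
    _ = _ := mul_one _

/-- Each `x` is a branch image of some `y`, so a bound `η` on the differences at all points improves
to `z * η` plus an arbitrarily small error, `z` being the largest weight. Uniformity in `x` is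
essential, since `y` varies with it. -/
theorem uniform_cauchy {δ : ℝ} (hδ : 0 < δ) :
    ∃ M, ∀ n ≥ M, ∀ n' ≥ M, ∀ x ∈ Icc (0 : ℝ) 1,
      |z ^ n * ((oddMLe n x).ncard : ℝ) - z ^ n' * ((oddMLe n' x).ncard : ℝ)| ≤ δ := by
  have h0 := hz.pos
  have h1 := hz.lt_one
  obtain ⟨c, -, hc⟩ := hz.exists_tendsto_ncard
  set κ : ℕ → ℝ := fun n => z ^ n * ((oddM n).ncard : ℝ) with hκ
  set g : ℕ → ℝ → ℝ := fun n x => z ^ n * ((oddMLe n x).ncard : ℝ) with hg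
  let P : ℝ → Prop := fun η => ∃ M, ∀ n ≥ M, ∀ n' ≥ M, ∀ x ∈ Icc (0 : ℝ) 1, |g n x - g n' x| ≤ η
  have mono {η η' : ℝ} (h : η ≤ η') : P η → P η' := fun ⟨M, hM⟩ =>
    ⟨M, fun n hn n' hn' x hx => (hM n hn n' hn' x hx).trans h⟩
  have hleft (n : ℕ) {x : ℝ} (hx : x ∈ Icc (0 : ℝ) 1) :
      |g (n + 3) (leftMap x) - z * (κ (n + 2) - g (n + 2) x)| ≤ z ^ n :=
    hz.abs_pow_mul_ncard_oddMLe_leftMap_sub_le n hx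
  have hmid (n : ℕ) {x : ℝ} (hx : x ∈ Icc (0 : ℝ) 1) :
      g (n + 3) (midMap x) = z * κ (n + 2) + z ^ 3 * g n x - z ^ 3 * z ^ n :=
    pow_mul_ncard_oddMLe_midMap z n hx
  have hright (n : ℕ) {x : ℝ} (hx : x ∈ Icc (0 : ℝ) 1) :
      g (n + 3) (rightMap x) =
        z * κ (n + 2) + z ^ 3 * κ n + z ^ 2 * g (n + 1) x - z ^ 3 * (2 * z ^ n) :=
    pow_mul_ncard_oddMLe_rightMap z n hx
  have hz2 : z ^ 2 ≤ z := by nlinarith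
  have hz3 : z ^ 3 ≤ z := by nlinarith
  have hz31 : z ^ 3 ≤ 1 := by linarith
  have step {η ε : ℝ} (hε : 0 < ε) (hP : P η) : P (z * η + ε) := by
    obtain ⟨M, hM⟩ := hP
    obtain ⟨M₁, hM₁⟩ := (Metric.cauchySeq_iff.1 hc.cauchySeq) (ε / 8) (by positivity)
    obtain ⟨M₂, hM₂⟩ := eventually_atTop.1 ((tendsto_pow_atTop_nhds_zero_of_lt_one h0.le h1).eventually
      (ge_mem_nhds (show (0 : ℝ) < ε / 8 by positivity)))
    set L := max M (max M₁ M₂)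
    have hL : M ≤ L ∧ M₁ ≤ L ∧ M₂ ≤ L := by omega
    have hη : 0 ≤ η := (abs_nonneg _).trans (hM M le_rfl M le_rfl 0 (by simp))
    refine ⟨L + 3, fun n hn n' hn' x hx => ?_⟩
    obtain ⟨i, rfl⟩ : ∃ i, n = i + 3 := ⟨n - 3, by omega⟩
    obtain ⟨j, rfl⟩ : ∃ j, n' = j + 3 := ⟨n' - 3, by omega⟩
    have c2 : |κ (i + 2) - κ (j + 2)| ≤ ε / 8 := (hM₁ _ (by omega) _ (by omega)).le
    have c0 : |κ i - κ j| ≤ ε / 8 := (hM₁ _ (by omega) _ (by omega)).le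
    have pi : z ^ i ≤ ε / 8 := hM₂ i (by omega)
    have pj : z ^ j ≤ ε / 8 := hM₂ j (by omega)
    have hε8 : 0 ≤ ε / 8 := by positivity
    have pi0 : 0 < z ^ i := by positivity
    have pj0 : 0 < z ^ j := by positivity
    have z2p : 0 < z ^ 2 := by positivity
    have z3p : 0 < z ^ 3 := by positivity
    have scale {w a b : ℝ} (hw : 0 < w) (h : |a| ≤ b) : -(w * b) ≤ w * a ∧ w * a ≤ w * b := by
      rw [abs_le] at h
      constructor <;> nlinarith
    obtain ⟨y, hy, rfl | rfl | rfl⟩ := exists_eq_map_of_mem hx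
    · have e1 := abs_le.1 (hleft i hy)
      have e2 := abs_le.1 (hleft j hy)
      have e3 := scale h0 c2
      have e4 := scale h0 (hM (i + 2) (by omega) (j + 2) (by omega) y hy)
      have := mul_le_of_le_one_left hε8 h1.le
      rw [abs_le]
      constructor <;> linarith
    · rw [hmid i hy, hmid j hy]
      have e3 := scale h0 c2
      have e4 := scale z3p (hM i (by omega) j (by omega) y hy)
      have := mul_le_of_le_one_left hε8 h1.le
      have := mul_le_mul_of_nonneg_right hz3 hη
      have := mul_le_of_le_one_left pi0.le hz31
      have := mul_le_of_le_one_left pj0.le hz31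
      have : 0 < z ^ 3 * z ^ i := by positivity
      have : 0 < z ^ 3 * z ^ j := by positivity
      rw [abs_le]
      constructor <;> linarith
    · rw [hright i hy, hright j hy]
      have e3 := scale h0 c2
      have e3' := scale z3p c0
      have e4 := scale z2p (hM (i + 1) (by omega) (j + 1) (by omega) y hy)
      have := mul_le_of_le_one_left hε8 h1.le
      have := mul_le_of_le_one_left hε8 hz31
      have := mul_le_mul_of_nonneg_right hz2 hη
      have := mul_le_of_le_one_left pi0.le hz31
      have := mul_le_of_le_one_left pj0.le hz31
      have : 0 < z ^ 3 * z ^ i := by positivity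
      have : 0 < z ^ 3 * z ^ j := by positivity
      rw [abs_le]
      constructor <;> linarith
  obtain ⟨η, hη⟩ : ∃ η, P η := by
    obtain ⟨B, hB⟩ := hc.bddAbove_range
    refine ⟨B, 0, fun n _ n' _ x _ => ?_⟩
    have bd (n : ℕ) : 0 ≤ g n x ∧ g n x ≤ B := by
      refine ⟨by positivity, le_trans ?_ (hB ⟨n, rfl⟩)⟩
      simp only [hg]
      exact mul_le_mul_of_nonneg_left
        (by exact_mod_cast ncard_le_ncard (oddMLe_subset n x) (finite_oddM n)) (by positivity)
    rw [abs_le]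
    constructor <;> linarith [(bd n).1, (bd n).2, (bd n').1, (bd n').2]
  have iter : ∀ k : ℕ, P (z ^ k * η + δ / 2) := by
    intro k
    induction k with
    | zero => exact mono (by linarith) hη
    | succ k ih =>
      -- This error makes `δ / 2` the fixed point of `η ↦ z * η + ε`.
      refine mono (le_of_eq ?_) (step (ε := (1 - z) * (δ / 2))
        (mul_pos (by linarith) (by positivity)) ih)
      ring
  have ht : Tendsto (fun k : ℕ => z ^ k * η) atTop (𝓝 0) := by
    simpa using (tendsto_pow_atTop_nhds_zero_of_lt_one h0.le h1).mul_const η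
  obtain ⟨k, hk⟩ := (ht.eventually (ge_mem_nhds (show (0 : ℝ) < δ / 2 by positivity))).exists
  exact mono (by linarith) (iter k)

end IsTribonacciRoot

/-! ### Self-similar functions and their cylinders -/

/-- `F` is a distribution function on `[0, 1]` that is self-similar with respect to `leftMap`,
`midMap`, `rightMap` with the weights `z`, `z ^ 3`, `z ^ 2`. -/
structure IsSelfSimilar (z : ℝ) (F : ℝ → ℝ) : Prop where
  monotoneOn : MonotoneOn F (Icc 0 1)
  zero : F 0 = 0
  one : F 1 = 1
  left : ∀ x ∈ Icc (0 : ℝ) 1, F (leftMap x) = z * (1 - F x)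
  mid : ∀ x ∈ Icc (0 : ℝ) 1, F (midMap x) = z + z ^ 3 * F x
  right : ∀ x ∈ Icc (0 : ℝ) 1, F (rightMap x) = z + z ^ 3 + z ^ 2 * F x

/-- Data of a Möbius map `w ↦ (a (1 - w) + b w) / (s (1 - w) + t w)` of `[0, 1]` into itself, of an
affine map `v ↦ α + β v`, and of a point `y`. -/
structure Cylinder where
  (a b s t α β y : ℝ)

namespace Cylinder

/-- The Möbius map of a cylinder. -/
noncomputable def map (c : Cylinder) (w : ℝ) : ℝ :=
  (c.a * (1 - w) + c.b * w) / (c.s * (1 - w) + c.t * w)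

/-- The Möbius map of `c` is unimodular, conjugates `F` to its affine image, and maps `y` to `x`. -/
structure Valid (c : Cylinder) (F : ℝ → ℝ) (x : ℝ) : Prop where
  one_le_s : 1 ≤ c.s
  one_le_t : 1 ≤ c.t
  det : |c.b * c.s - c.a * c.t| = 1
  y_mem : c.y ∈ Icc (0 : ℝ) 1
  map_y : c.map c.y = x
  map_mem : ∀ w ∈ Icc (0 : ℝ) 1, c.map w ∈ Icc (0 : ℝ) 1
  F_map : ∀ w ∈ Icc (0 : ℝ) 1, F (c.map w) = c.α + c.β * F w
  β_ne : c.β ≠ 0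

/-- The slope of `F` over the image of `[0, 1]`, up to sign. -/
def ratio (c : Cylinder) : ℝ := |c.β| * (c.s * c.t)

/-- The subdivision relation between cylinders. -/
def IsChild (z : ℝ) (c c' : Cylinder) : Prop :=
  (c'.s = c.s + c.t ∧ c'.t = c.s ∧ |c'.β| = z * |c.β|) ∨
  (c'.s = c.s + c.t ∧ c'.t = c.s + 2 * c.t ∧ |c'.β| = z ^ 3 * |c.β|) ∨
  (c'.s = c.s + 2 * c.t ∧ c'.t = c.t ∧ |c'.β| = z ^ 2 * |c.β|)

theorem Valid.denom_pos {c : Cylinder} {F : ℝ → ℝ} {x : ℝ} (h : c.Valid F x) {w : ℝ}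
    (hw : w ∈ Icc (0 : ℝ) 1) : 0 < c.s * (1 - w) + c.t * w := by
  have := h.one_le_s
  have := h.one_le_t
  obtain ⟨h0, h1⟩ := hw
  nlinarith

/-- The child is `c.map` composed with the branch whose image contains `c.y`. The points `1/2` and
`2/3` go to `(a + b) / (s + t)` and `(a + 2b) / (s + 2t)`, so the new coefficients are those of
mediants. -/
theorem Valid.exists_child {c : Cylinder} {F : ℝ → ℝ} {x z : ℝ} (h : c.Valid F x)
    (hz : 0 < z) (hF : IsSelfSimilar z F) : ∃ c', c'.Valid F x ∧ IsChild z c c' := by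
  have hs := h.one_le_s
  have ht := h.one_le_t
  obtain ⟨y, hy, e⟩ := exists_eq_map_of_mem h.y_mem
  have sub_mem {f : ℝ → ℝ} {p q : ℝ} (hf : ∀ w ∈ Icc (0 : ℝ) 1, f w ∈ Icc p q) (hp : 0 ≤ p)
      (hq : q ≤ 1) : ∀ w ∈ Icc (0 : ℝ) 1, f w ∈ Icc (0 : ℝ) 1 := fun w hw =>
    ⟨hp.trans (hf w hw).1, (hf w hw).2.trans hq⟩
  have mk (c' : Cylinder) (f : ℝ → ℝ) (hs : 1 ≤ c'.s) (ht : 1 ≤ c'.t)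
      (hdet : |c'.b * c'.s - c'.a * c'.t| = 1) (hy' : c'.y = y) (hβ : c'.β ≠ 0)
      (hf : ∀ w ∈ Icc (0 : ℝ) 1, f w ∈ Icc (0 : ℝ) 1) (hxy : c.y = f y)
      (hmap : ∀ w ∈ Icc (0 : ℝ) 1, c'.map w = c.map (f w))
      (hF' : ∀ w ∈ Icc (0 : ℝ) 1, c.α + c.β * F (f w) = c'.α + c'.β * F w) : c'.Valid F x :=
    { one_le_s := hs
      one_le_t := ht
      det := hdet
      y_mem := hy' ▸ hy
      map_y := by rw [hy', hmap y hy, ← hxy, h.map_y]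
      map_mem := fun w hw => by rw [hmap w hw]; exact h.map_mem _ (hf w hw)
      F_map := fun w hw => by rw [hmap w hw, h.F_map _ (hf w hw), hF' w hw]
      β_ne := hβ }
  rcases e with e | e | e
  · refine ⟨⟨c.a + c.b, c.a, c.s + c.t, c.s, c.α + c.β * z, -c.β * z, y⟩,
      mk _ leftMap ?_ hs ?_ rfl ?_ (sub_mem (fun w => leftMap_mem) le_rfl (by norm_num)) e ?_ ?_,
      .inl ⟨rfl, rfl, ?_⟩⟩
    · show 1 ≤ c.s + c.t
      linarith
    · rw [← h.det, ← abs_neg]; congr 1; ring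
    · exact mul_ne_zero (neg_ne_zero.2 h.β_ne) hz.ne'
    · intro w hw
      have h2 : 0 < 2 - w := by linarith [hw.2]
      simp only [map, leftMap]
      rw [show 1 - (1 - w) / (2 - w) = 1 / (2 - w) by field_simp; ring,
        show c.a * (1 / (2 - w)) + c.b * ((1 - w) / (2 - w)) =
          (c.a + c.b * (1 - w)) / (2 - w) by field_simp,
        show c.s * (1 / (2 - w)) + c.t * ((1 - w) / (2 - w)) =
          (c.s + c.t * (1 - w)) / (2 - w) by field_simp, div_div_div_cancel_right₀ h2.ne']
      congr 1 <;> ring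
    · intro w hw
      rw [hF.left w hw]; ring
    · rw [abs_mul, abs_neg, abs_of_pos hz, mul_comm]
  · refine ⟨⟨c.a + c.b, c.a + 2 * c.b, c.s + c.t, c.s + 2 * c.t, c.α + c.β * z, c.β * z ^ 3, y⟩,
      mk _ midMap ?_ ?_ ?_ rfl ?_
        (sub_mem (fun w => midMap_mem) (by norm_num) (by norm_num)) e ?_ ?_,
      .inr (.inl ⟨rfl, rfl, ?_⟩)⟩
    · show 1 ≤ c.s + c.t
      linarith
    · show 1 ≤ c.s + 2 * c.t
      linarith
    · rw [← h.det]; congr 1; ring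
    · exact mul_ne_zero h.β_ne (pow_pos hz 3).ne'
    · intro w hw
      have h2 : 0 < 2 + w := by linarith [hw.1]
      simp only [map, midMap]
      rw [show 1 - (1 + w) / (2 + w) = 1 / (2 + w) by field_simp; ring,
        show c.a * (1 / (2 + w)) + c.b * ((1 + w) / (2 + w)) =
          (c.a + c.b * (1 + w)) / (2 + w) by field_simp,
        show c.s * (1 / (2 + w)) + c.t * ((1 + w) / (2 + w)) =
          (c.s + c.t * (1 + w)) / (2 + w) by field_simp, div_div_div_cancel_right₀ h2.ne']
      congr 1 <;> ring
    · intro w hw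
      rw [hF.mid w hw]; ring
    · rw [abs_mul, abs_of_pos (pow_pos hz 3), mul_comm]
  · refine ⟨⟨c.a + 2 * c.b, c.b, c.s + 2 * c.t, c.t, c.α + c.β * (z + z ^ 3), c.β * z ^ 2, y⟩,
      mk _ rightMap ?_ ht ?_ rfl ?_
        (sub_mem (fun w => rightMap_mem) (by norm_num) le_rfl) e ?_ ?_,
      .inr (.inr ⟨rfl, rfl, ?_⟩)⟩
    · show 1 ≤ c.s + 2 * c.t
      linarith
    · rw [← h.det]; congr 1; ring
    · exact mul_ne_zero h.β_ne (pow_pos hz 2).ne'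
    · intro w hw
      have h2 : 0 < 3 - 2 * w := by linarith [hw.2]
      simp only [map, rightMap]
      rw [show 1 - (2 - w) / (3 - 2 * w) = (1 - w) / (3 - 2 * w) by field_simp; ring,
        show c.a * ((1 - w) / (3 - 2 * w)) + c.b * ((2 - w) / (3 - 2 * w)) =
          (c.a * (1 - w) + c.b * (2 - w)) / (3 - 2 * w) by field_simp,
        show c.s * ((1 - w) / (3 - 2 * w)) + c.t * ((2 - w) / (3 - 2 * w)) =
          (c.s * (1 - w) + c.t * (2 - w)) / (3 - 2 * w) by field_simp,
        div_div_div_cancel_right₀ h2.ne']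
      congr 1 <;> ring
    · intro w hw
      rw [hF.right w hw]; ring
    · rw [abs_mul, abs_of_pos (pow_pos hz 2), mul_comm]

theorem IsChild.mul_add_one_le {c c' : Cylinder} {z : ℝ} (h : IsChild z c c') (hs : 1 ≤ c.s)
    (ht : 1 ≤ c.t) : c.s * c.t + 1 ≤ c'.s * c'.t := by
  rcases h with ⟨h1, h2, -⟩ | ⟨h1, h2, -⟩ | ⟨h1, h2, -⟩ <;> rw [h1, h2] <;> nlinarith

theorem exists_seq {F : ℝ → ℝ} {x z : ℝ} (hz : 0 < z) (hF : IsSelfSimilar z F)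
    (hx : x ∈ Icc (0 : ℝ) 1) :
    ∃ c : ℕ → Cylinder, (∀ n, (c n).Valid F x) ∧ (∀ n, IsChild z (c n) (c (n + 1))) ∧
      Tendsto (fun n => (c n).s * (c n).t) atTop atTop := by
  let c₀ : Cylinder := ⟨0, 1, 1, 1, 0, 1, x⟩
  have hmap (w : ℝ) : c₀.map w = w := by simp [c₀, map]
  have h₀ : c₀.Valid F x :=
    { one_le_s := le_rfl
      one_le_t := le_rfl
      det := by simp [c₀]
      y_mem := hx
      map_y := hmap x
      map_mem := fun w hw => by rwa [hmap]
      F_map := fun w _ => by simp [hmap, c₀]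
      β_ne := one_ne_zero }
  choose next hv hc using fun c : {c : Cylinder // c.Valid F x} => c.2.exists_child hz hF
  let f : {c : Cylinder // c.Valid F x} → {c : Cylinder // c.Valid F x} := fun c => ⟨next c, hv c⟩
  have hchild (n : ℕ) : IsChild z (f^[n] ⟨c₀, h₀⟩).1 (f^[n + 1] ⟨c₀, h₀⟩).1 := by
    rw [Function.iterate_succ_apply']
    exact hc _
  refine ⟨fun n => (f^[n] ⟨c₀, h₀⟩).1, fun n => (f^[n] ⟨c₀, h₀⟩).2, hchild, ?_⟩
  refine tendsto_atTop_mono (fun n => ?_) tendsto_natCast_atTop_atTop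
  induction n with
  | zero => simp [c₀]
  | succ n ih =>
    have := (hchild n).mul_add_one_le (f^[n] ⟨c₀, h₀⟩).2.one_le_s (f^[n] ⟨c₀, h₀⟩).2.one_le_t
    push_cast
    linarith

/-- The endpoints `a / s` and `b / t` enclose `x`, so their distances to `x` add up to the length `1
/ (s t)`. Adding the linear approximations of `F` there compares the increment `β` with `d` times
the signed length. -/
theorem Valid.ratio_sub_le {c : Cylinder} {F : ℝ → ℝ} {x z d ε : ℝ} (h : c.Valid F x)
    (hF : IsSelfSimilar z F)
    (hd : ∀ y ∈ Icc (0 : ℝ) 1, |y - x| ≤ 1 / (c.s * c.t) →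
      |F y - F x - d * (y - x)| ≤ ε * |y - x|) : abs (c.ratio - |d|) ≤ ε := by
  have hs : 0 < c.s := by linarith [h.one_le_s]
  have ht : 0 < c.t := by linarith [h.one_le_t]
  have hD := h.denom_pos h.y_mem
  obtain ⟨hy0, hy1⟩ := h.y_mem
  set D := c.s * (1 - c.y) + c.t * c.y with hDdef
  have hx : x = (c.a * (1 - c.y) + c.b * c.y) / D := h.map_y.symm
  have e0 : c.map 0 = c.a / c.s := by simp [map]
  have e1 : c.map 1 = c.b / c.t := by simp [map]
  have hu : |c.a / c.s - x| = c.y / (c.s * D) := by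
    have : c.a / c.s - x = -(c.b * c.s - c.a * c.t) * (c.y / (c.s * D)) := by
      rw [hx]; field_simp; rw [hDdef]; ring
    rw [this, abs_mul, abs_neg, h.det, one_mul, abs_of_nonneg (by positivity)]
  have hv : |c.b / c.t - x| = (1 - c.y) / (c.t * D) := by
    have : c.b / c.t - x = (c.b * c.s - c.a * c.t) * ((1 - c.y) / (c.t * D)) := by
      rw [hx]; field_simp; rw [hDdef]; ring
    rw [this, abs_mul, h.det, one_mul, abs_of_nonneg (div_nonneg (by linarith) (by positivity))]
  have hsum : |c.a / c.s - x| + |c.b / c.t - x| = 1 / (c.s * c.t) := by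
    rw [hu, hv]; field_simp; rw [hDdef]; ring
  have huv : |c.b / c.t - c.a / c.s| = 1 / (c.s * c.t) := by
    have : c.b / c.t - c.a / c.s = (c.b * c.s - c.a * c.t) * (1 / (c.s * c.t)) := by
      field_simp
    rw [this, abs_mul, h.det, one_mul, abs_of_pos (by positivity)]
  have m0 := h.map_mem 0 (by simp)
  have m1 := h.map_mem 1 (by simp)
  have f0 := h.F_map 0 (by simp)
  have f1 := h.F_map 1 (by simp)
  rw [e0] at m0 f0
  rw [e1] at m1 f1
  rw [hF.zero] at f0
  rw [hF.one] at f1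
  have d0 := hd _ m0 (by linarith [abs_nonneg (c.b / c.t - x)])
  have d1 := hd _ m1 (by linarith [abs_nonneg (c.a / c.s - x)])
  have key : |c.β - d * (c.b / c.t - c.a / c.s)| ≤ ε * (1 / (c.s * c.t)) := by
    rw [← hsum]
    calc _ = |(F (c.b / c.t) - F x - d * (c.b / c.t - x)) -
          (F (c.a / c.s) - F x - d * (c.a / c.s - x))| := by rw [f0, f1]; congr 1; ring
      _ ≤ |F (c.b / c.t) - F x - d * (c.b / c.t - x)| +
          |F (c.a / c.s) - F x - d * (c.a / c.s - x)| := abs_sub _ _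
      _ ≤ _ := by linarith
  have key2 := (abs_abs_sub_abs_le _ _).trans key
  rw [abs_mul, huv] at key2
  have e : c.ratio - |d| = (|c.β| - |d| * (1 / (c.s * c.t))) * (c.s * c.t) := by
    rw [ratio]; field_simp
  rw [e, abs_mul, abs_of_pos (by positivity : 0 < c.s * c.t)]
  calc _ ≤ ε * (1 / (c.s * c.t)) * (c.s * c.t) := by gcongr
    _ = ε := by field_simp

/-! ### Incompatibility of consecutive subdivisions -/

/-- The range of the ratio `s / t` in cylinders with a subdivision that almost preserves the
slope. -/
def IsBalanced (c : Cylinder) : Prop :=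
  (0.82 * c.t ≤ c.s ∧ c.s ≤ 0.86 * c.t) ∨ (2.33 * c.t ≤ c.s ∧ c.s ≤ 2.44 * c.t)

/-- Put `r = s / t`. Exact preservation of the slope means `z (r + 1) = 1`, `z³ (r + 1) (r + 2) = r`
or `z² (r + 2) = r`. All three hold at `r = z + z² ≈ 0.839`, and the middle one also at `r = 2 / (z
+ z²) ≈ 2.384`; hence the two ranges. The child has ratio `1 + 1 / r ≈ 2.19`, `(r + 1) / (r + 2) ≈
0.65` or `0.77`, or `r + 2 ≈ 2.84`, always outside them. -/
theorem IsChild.isBalanced {c c' : Cylinder} {z : ℝ} (hz : IsTribonacciRoot z)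
    (h : IsChild z c c') (hs : 1 ≤ c.s) (ht : 1 ≤ c.t) (hβ : c.β ≠ 0)
    (h1 : 0.995 * c.ratio ≤ c'.ratio) (h2 : c'.ratio ≤ 1.005 * c.ratio) :
    c.IsBalanced ∧ ¬ c'.IsBalanced := by
  have hz0 := hz.pos
  have l1 := hz.lower
  have u1 := hz.upper
  have l2 : 0.2955 < z ^ 2 := by nlinarith
  have u2 : z ^ 2 < 0.29562 := by nlinarith
  have l3 : 0.1606 < z ^ 3 := by nlinarith
  have u3 : z ^ 3 < 0.16075 := by nlinarith
  have hB : 0 < |c.β| := abs_pos.2 hβ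
  unfold ratio at h1 h2
  have cancel {p q r : ℝ} (hr : 0 < r) (h : r * p ≤ r * q) : p ≤ q := le_of_mul_le_mul_left h hr
  rcases h with ⟨e1, e2, e3⟩ | ⟨e1, e2, e3⟩ | ⟨e1, e2, e3⟩ <;> rw [e1, e2, e3] at h1 h2 <;>
    unfold IsBalanced <;> rw [e1, e2]
  · have k : 0 < |c.β| * c.s := by positivity
    have a1 : 0.995 * c.t ≤ z * (c.s + c.t) := cancel k (by linarith)
    have a2 : z * (c.s + c.t) ≤ 1.005 * c.t := cancel k (by linarith)
    have b1 : 0.82 * c.t ≤ c.s := by nlinarith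
    have b2 : c.s ≤ 0.86 * c.t := by nlinarith
    refine ⟨.inl ⟨b1, b2⟩, ?_⟩
    rintro (⟨h3, h4⟩ | ⟨h3, h4⟩) <;> linarith
  · have a1 : 0.995 * (c.s * c.t) ≤ z ^ 3 * ((c.s + c.t) * (c.s + 2 * c.t)) :=
      cancel hB (by linarith)
    have a2 : z ^ 3 * ((c.s + c.t) * (c.s + 2 * c.t)) ≤ 1.005 * (c.s * c.t) :=
      cancel hB (by linarith)
    have k : 0 < (c.s + c.t) * (c.s + 2 * c.t) := by positivity
    have b1 : 6.189 * (c.s * c.t) ≤ (c.s + c.t) * (c.s + 2 * c.t) := by nlinarith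
    have b2 : (c.s + c.t) * (c.s + 2 * c.t) ≤ 6.258 * (c.s * c.t) := by nlinarith
    -- The upper bound reads `r² - 3.258 r + 2 ≤ 0` and keeps `r` between the roots; the lower one,
    -- `r² - 3.189 r + 2 ≥ 0`, removes the middle. The factors below use `2.438 = 3.258 - 0.82` and
    -- `0.818 = 3.258 - 2.44` to match the linear term.
    have c1 : 0.82 * c.t ≤ c.s := by
      by_contra! hlt
      nlinarith [mul_pos (sub_pos.2 hlt) (show 0 < 2.438 * c.t - c.s by linarith)]
    have c2 : c.s ≤ 2.44 * c.t := by
      by_contra! hlt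
      nlinarith [mul_pos (sub_pos.2 hlt) (show 0 < c.s - 0.818 * c.t by linarith)]
    have c3 : c.s ≤ 0.86 * c.t ∨ 2.33 * c.t ≤ c.s := by
      by_contra! hlt
      nlinarith [mul_pos (sub_pos.2 hlt.1) (sub_pos.2 hlt.2)]
    have bal : (0.82 * c.t ≤ c.s ∧ c.s ≤ 0.86 * c.t) ∨ (2.33 * c.t ≤ c.s ∧ c.s ≤ 2.44 * c.t) := by
      rcases c3 with h | h
      exacts [.inl ⟨c1, h⟩, .inr ⟨h, c2⟩]
    refine ⟨bal, ?_⟩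
    rintro (⟨h3, h4⟩ | ⟨h3, h4⟩) <;> rcases bal with ⟨h5, h6⟩ | ⟨h5, h6⟩ <;> linarith
  · have k : 0 < |c.β| * c.t := by positivity
    have a1 : 0.995 * c.s ≤ z ^ 2 * (c.s + 2 * c.t) := cancel k (by linarith)
    have a2 : z ^ 2 * (c.s + 2 * c.t) ≤ 1.005 * c.s := cancel k (by linarith)
    have b1 : 0.82 * c.t ≤ c.s := by nlinarith
    have b2 : c.s ≤ 0.86 * c.t := by nlinarith
    refine ⟨.inl ⟨b1, b2⟩, ?_⟩
    rintro (⟨h3, h4⟩ | ⟨h3, h4⟩) <;> linarith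

end Cylinder

/-! ### Derivatives and continuity of self-similar functions -/

namespace IsSelfSimilar

theorem mapsTo_Icc {z : ℝ} {F : ℝ → ℝ} (hF : IsSelfSimilar z F) :
    MapsTo F (Icc 0 1) (Icc 0 1) := fun x hx => by
  rw [← hF.zero, ← hF.one]
  exact ⟨hF.monotoneOn (by simp) hx hx.1, hF.monotoneOn hx (by simp) hx.2⟩

variable {z : ℝ} {F : ℝ → ℝ} (hF : IsSelfSimilar z F) (hz : IsTribonacciRoot z)
include hF hz

theorem eq_zero_of_hasDerivWithinAt {x d : ℝ} (hx : x ∈ Icc (0 : ℝ) 1)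
    (hd : HasDerivWithinAt F d (Icc 0 1) x) : d = 0 := by
  by_contra hne
  have hpos : 0 < |d| := abs_pos.2 hne
  obtain ⟨c, hv, hc, ht⟩ := Cylinder.exists_seq hz.pos hF hx
  -- Two slopes within 0.1% of `|d|` differ by less than the 0.5% allowed in `isBalanced`.
  have hε : 0 < 0.001 * |d| := by positivity
  have ho := (hasDerivWithinAt_iff_isLittleO.1 hd).def hε
  obtain ⟨δ, hδ, hδ'⟩ := Metric.mem_nhdsWithin_iff.1 ho
  have near : ∀ᶠ n in atTop, abs ((c n).ratio - |d|) ≤ 0.001 * |d| := by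
    filter_upwards [(tendsto_inv_atTop_zero.comp ht).eventually (gt_mem_nhds hδ)] with n hn
    refine (hv n).ratio_sub_le hF fun y hy hyx => ?_
    have hy' : y ∈ Metric.ball x δ ∩ Icc 0 1 := by
      refine ⟨?_, hy⟩
      rw [Metric.mem_ball, Real.dist_eq]
      refine hyx.trans_lt ?_
      rw [one_div]
      exact hn
    have := hδ' hy'
    simpa [mul_comm d] using this
  obtain ⟨N, hN⟩ := eventually_atTop.1 near
  have bal (n : ℕ) (hn : N ≤ n) : (c n).IsBalanced ∧ ¬ (c (n + 1)).IsBalanced := by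
    have h1 := abs_le.1 (hN n hn)
    have h2 := abs_le.1 (hN (n + 1) (by omega))
    exact (hc n).isBalanced hz (hv n).one_le_s (hv n).one_le_t (hv n).β_ne (by linarith)
      (by linarith)
  exact (bal N le_rfl).2 (bal (N + 1) (by omega)).1

/-- The intervals `[0, z]`, `[z, z + z³]`, `[z + z³, 1]` are affine copies of `[0, 1]`.
Approximating the rescaled `t` and applying the matching branch shrinks the error by a factor of at
most `z`. -/
theorem exists_near {t : ℝ} (ht : t ∈ Icc (0 : ℝ) 1) {ε : ℝ} (hε : 0 < ε) :
    ∃ x ∈ Icc (0 : ℝ) 1, |F x - t| < ε := by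
  have h0 := hz.pos
  have h1 := hz.lt_one
  have h4 := hz.eq_one
  have key : ∀ k : ℕ, ∀ t ∈ Icc (0 : ℝ) 1, ∃ x ∈ Icc (0 : ℝ) 1, |F x - t| ≤ z ^ k := by
    intro k
    induction k with
    | zero =>
      rintro t ⟨ht0, ht1⟩
      refine ⟨0, by simp, ?_⟩
      rw [hF.zero, pow_zero, abs_le]
      constructor <;> linarith
    | succ k ih =>
      rintro t ⟨ht0, ht1⟩
      have shrink {w a b : ℝ} (hw : 0 < w) (hwz : w ≤ z) (h : |a| ≤ z ^ k) (e : b = w * a ∨ b = -(w * a)) :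
          |b| ≤ z ^ (k + 1) := by
        have : |b| = w * |a| := by
          rcases e with rfl | rfl
          · rw [abs_mul, abs_of_pos hw]
          · rw [abs_neg, abs_mul, abs_of_pos hw]
        rw [this, pow_succ']
        gcongr
      have hz2 : z ^ 2 ≤ z := by nlinarith
      have hz3 : z ^ 3 ≤ z := by nlinarith
      have p2 : 0 < z ^ 2 := by positivity
      have p3 : 0 < z ^ 3 := by positivity
      rcases le_total t z with h | h
      · obtain ⟨x, hx, hxt⟩ := ih (1 - t / z)
          ⟨by rw [sub_nonneg, div_le_one h0]; exact h, by linarith [div_nonneg ht0 h0.le]⟩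
        refine ⟨leftMap x, ⟨(leftMap_mem hx).1, (leftMap_mem hx).2.trans (by norm_num)⟩, ?_⟩
        refine shrink h0 le_rfl hxt (.inr ?_)
        rw [hF.left x hx]
        field_simp
        ring
      rcases le_total t (z + z ^ 3) with h' | h'
      · obtain ⟨x, hx, hxt⟩ := ih ((t - z) / z ^ 3)
          ⟨div_nonneg (by linarith) p3.le, by rw [div_le_one p3]; linarith⟩
        refine ⟨midMap x, ⟨le_trans (by norm_num) (midMap_mem hx).1,
          (midMap_mem hx).2.trans (by norm_num)⟩, ?_⟩
        refine shrink p3 hz3 hxt (.inl ?_)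
        rw [hF.mid x hx]
        field_simp
        ring
      · obtain ⟨x, hx, hxt⟩ := ih ((t - z - z ^ 3) / z ^ 2)
          ⟨div_nonneg (by linarith) p2.le, by rw [div_le_one p2]; linarith⟩
        refine ⟨rightMap x, ⟨le_trans (by norm_num) (rightMap_mem hx).1, (rightMap_mem hx).2⟩, ?_⟩
        refine shrink p2 hz2 hxt (.inl ?_)
        rw [hF.right x hx]
        field_simp
        ring
  obtain ⟨k, hk⟩ := exists_pow_lt_of_lt_one hε h1
  obtain ⟨x, hx, h⟩ := key k t ht
  exact ⟨x, hx, h.trans_lt hk⟩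

/-- A jump of a monotone function would leave a gap in its range, which is dense by `exists_near`.
-/
theorem continuousOn : ContinuousOn F (Icc 0 1) := by
  let G : Icc (0 : ℝ) 1 → Icc (0 : ℝ) 1 := hF.mapsTo_Icc.restrict F _ _
  have hG : Monotone G := fun x y h => hF.monotoneOn x.2 y.2 h
  have hd : DenseRange G := by
    intro t
    rw [Metric.mem_closure_iff]
    intro ε hε
    obtain ⟨x, hx, h⟩ := hF.exists_near hz t.2 hε
    refine ⟨G ⟨x, hx⟩, ⟨_, rfl⟩, ?_⟩
    rw [dist_comm, Subtype.dist_eq, Real.dist_eq]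
    exact h
  rw [continuousOn_iff_continuous_domRestrict]
  exact continuous_subtype_val.comp (hG.continuous_of_denseRange hd)

theorem isSingularOn : IsSingularOn F 0 1 where
  monotone := hF.monotoneOn
  continuous := hF.continuousOn hz
  lt := by rw [hF.zero, hF.one]; exact one_pos
  deriv := by
    filter_upwards [hF.monotoneOn.ae_differentiableWithinAt measurableSet_Icc,
      ae_restrict_mem measurableSet_Icc] with x hx hmem
    have h := hx.hasDerivWithinAt
    rwa [hF.eq_zero_of_hasDerivWithinAt hz hmem h] at h

theorem eq_zero_or_eq_top {x : ℝ} (hx : x ∈ Icc (0 : ℝ) 1) {d : EReal}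
    (hd : HasExtDerivWithinAt F d (Icc 0 1) x) : d = 0 ∨ d = ⊤ := by
  have hne : (𝓝[Icc (0 : ℝ) 1 \ {x}] x).NeBot := by
    have := (uniqueDiffOn_Icc (zero_lt_one (α := ℝ)) x hx).accPt
    rwa [accPt_principal_iff_nhdsWithin] at this
  induction d with
  | top => exact .inr rfl
  | bot =>
    exfalso
    have h : (0 : EReal) ≤ ⊥ := by
      refine ge_of_tendsto hd ?_
      filter_upwards [self_mem_nhdsWithin] with y hy
      have : 0 ≤ slope F x y := hF.monotoneOn.slope_nonneg hx hy.1
      exact_mod_cast this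
    simp at h
  | coe r =>
    left
    have h : HasDerivWithinAt F r (Icc 0 1) x := by
      rw [hasDerivWithinAt_iff_tendsto_slope]
      exact EReal.tendsto_coe.1 hd
    rw [hF.eq_zero_of_hasDerivWithinAt hz hx h, EReal.coe_zero]

end IsSelfSimilar

/-! ### Existence and self-similarity of `oddF` -/

theorem oddDistrib_eq_div {z : ℝ} (hz : 0 < z) (n : ℕ) (x : ℝ) :
    oddDistrib n x =
      z ^ n * ((oddMLe n x).ncard : ℝ) / (z ^ n * ((oddM n).ncard : ℝ)) := by
  rw [mul_div_mul_left _ _ (pow_pos hz n).ne']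
  rfl

theorem oddDistrib_mono (n : ℕ) : Monotone (oddDistrib n) := by
  intro x y h
  have hsub : oddMLe n x ⊆ oddMLe n y := fun ξ hξ => ⟨hξ.1, hξ.2.trans h⟩
  have : ((oddMLe n x).ncard : ℝ) ≤ (oddMLe n y).ncard := by
    exact_mod_cast ncard_le_ncard hsub (finite_oddMLe n y)
  exact div_le_div_of_nonneg_right this (Nat.cast_nonneg _)

theorem oddDistrib_one (n : ℕ) : oddDistrib n 1 = 1 := by
  have h : ((oddM n).ncard : ℝ) ≠ 0 := by
    have := two_le_ncard_oddM n
    positivity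
  have e : oddDistrib n 1 = ((oddMLe n 1).ncard : ℝ) / (oddM n).ncard := rfl
  rw [e, oddMLe_one, div_self h]

namespace IsTribonacciRoot

variable {z : ℝ} (hz : IsTribonacciRoot z)
include hz

theorem tendsto_oddDistrib {x : ℝ} (hx : x ∈ Icc (0 : ℝ) 1) :
    Tendsto (fun n => oddDistrib n x) atTop (𝓝 (oddF x)) := by
  obtain ⟨c, hc0, hc⟩ := hz.exists_tendsto_ncard
  have hcau : CauchySeq fun n => z ^ n * ((oddMLe n x).ncard : ℝ) := by
    rw [Metric.cauchySeq_iff]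
    intro ε hε
    obtain ⟨M, hM⟩ := hz.uniform_cauchy (half_pos hε)
    exact ⟨M, fun m hm n hn => (hM m hm n hn x hx).trans_lt (half_lt_self hε)⟩
  obtain ⟨l, hl⟩ := cauchySeq_tendsto_of_complete hcau
  refine tendsto_nhds_limUnder ⟨l / c, ?_⟩
  exact (hl.div hc hc0.ne').congr fun n => (oddDistrib_eq_div hz.pos n x).symm

theorem tendsto_pow_mul_ncard_oddMLe {c : ℝ}
    (hc : Tendsto (fun n => z ^ n * ((oddM n).ncard : ℝ)) atTop (𝓝 c)) {x : ℝ}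
    (hx : x ∈ Icc (0 : ℝ) 1) :
    Tendsto (fun n => z ^ n * ((oddMLe n x).ncard : ℝ)) atTop (𝓝 (oddF x * c)) := by
  refine ((hz.tendsto_oddDistrib hx).mul hc).congr fun n => ?_
  have h : ((oddM n).ncard : ℝ) ≠ 0 := by
    have := two_le_ncard_oddM n
    positivity
  rw [oddDistrib_eq_div hz.pos, div_mul_cancel₀]
  exact mul_ne_zero (pow_pos hz.pos n).ne' h

/-- The scaled counting identities pass to the limit, where the endpoint corrections vanish; the
common factor `c > 0` cancels. -/
theorem isSelfSimilar_oddF : IsSelfSimilar z oddF := by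
  obtain ⟨c, hc0, hc⟩ := hz.exists_tendsto_ncard
  have hg {x : ℝ} (hx : x ∈ Icc (0 : ℝ) 1) := hz.tendsto_pow_mul_ncard_oddMLe hc hx
  have hpow : Tendsto (fun n : ℕ => z ^ n) atTop (𝓝 0) :=
    tendsto_pow_atTop_nhds_zero_of_lt_one hz.pos.le hz.lt_one
  have hone : oddF 1 = 1 := by
    refine tendsto_nhds_unique (hz.tendsto_oddDistrib (by simp)) ?_
    simp only [oddDistrib_one]
    exact tendsto_const_nhds
  have hleft : ∀ x ∈ Icc (0 : ℝ) 1, oddF (leftMap x) = z * (1 - oddF x) := by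
    intro x hx
    have hx' : leftMap x ∈ Icc (0 : ℝ) 1 :=
      ⟨(leftMap_mem hx).1, (leftMap_mem hx).2.trans (by norm_num)⟩
    have h1 := squeeze_zero_norm
      (fun n => (Real.norm_eq_abs _).trans_le (hz.abs_pow_mul_ncard_oddMLe_leftMap_sub_le n hx)) hpow
    have h2 := ((tendsto_add_atTop_iff_nat 3).2 (hg hx')).sub
      ((((tendsto_add_atTop_iff_nat 2).2 hc).sub
        ((tendsto_add_atTop_iff_nat 2).2 (hg hx))).const_mul z)
    have h3 := tendsto_nhds_unique h2 h1
    refine mul_right_cancel₀ hc0.ne' ?_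
    linear_combination h3
  have hmid : ∀ x ∈ Icc (0 : ℝ) 1, oddF (midMap x) = z + z ^ 3 * oddF x := by
    intro x hx
    have hx' : midMap x ∈ Icc (0 : ℝ) 1 :=
      ⟨le_trans (by norm_num) (midMap_mem hx).1, (midMap_mem hx).2.trans (by norm_num)⟩
    have h1 := (tendsto_add_atTop_iff_nat 3).2 (hg hx')
    simp only [pow_mul_ncard_oddMLe_midMap z _ hx] at h1
    have h2 := ((((tendsto_add_atTop_iff_nat 2).2 hc).const_mul z).add
      ((hg hx).const_mul (z ^ 3))).sub (hpow.const_mul (z ^ 3))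
    have h3 := tendsto_nhds_unique h1 h2
    refine mul_right_cancel₀ hc0.ne' ?_
    linear_combination h3
  have hright : ∀ x ∈ Icc (0 : ℝ) 1, oddF (rightMap x) = z + z ^ 3 + z ^ 2 * oddF x := by
    intro x hx
    have hx' : rightMap x ∈ Icc (0 : ℝ) 1 :=
      ⟨le_trans (by norm_num) (rightMap_mem hx).1, (rightMap_mem hx).2⟩
    have h1 := (tendsto_add_atTop_iff_nat 3).2 (hg hx')
    simp only [pow_mul_ncard_oddMLe_rightMap z _ hx] at h1
    have h2 := (((((tendsto_add_atTop_iff_nat 2).2 hc).const_mul z).add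
      (hc.const_mul (z ^ 3))).add
      (((tendsto_add_atTop_iff_nat 1).2 (hg hx)).const_mul (z ^ 2))).sub
      ((hpow.const_mul 2).const_mul (z ^ 3))
    have h3 := tendsto_nhds_unique h1 h2
    refine mul_right_cancel₀ hc0.ne' ?_
    linear_combination h3
  refine ⟨fun x hx y hy h => ?_, ?_, hone, hleft, hmid, hright⟩
  · exact le_of_tendsto_of_tendsto' (hz.tendsto_oddDistrib hx) (hz.tendsto_oddDistrib hy)
      fun n => oddDistrib_mono n h
  -- The value at `0` comes from `leftMap 1 = 0`.
  · have := hleft 1 (by simp)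
    rwa [leftMap_one, hone, sub_self, mul_zero] at this

end IsTribonacciRoot

theorem theorem3 :
    (∀ x ∈ Icc (0 : ℝ) 1, Tendsto (fun n : ℕ => oddDistrib n x) atTop (𝓝 (oddF x))) ∧
    (∀ x ∈ Icc (0 : ℝ) 1, ∀ d : EReal,
      HasExtDerivWithinAt oddF d (Icc 0 1) x → d = 0 ∨ d = ⊤) ∧
    IsSingularOn oddF 0 1 := by
  obtain ⟨z, hz⟩ := exists_isTribonacciRoot
  have hF := hz.isSelfSimilar_oddF
  exact ⟨fun x hx => hz.tendsto_oddDistrib hx, fun x hx d hd => hF.eq_zero_or_eq_top hz hx hd,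
    hF.isSingularOn hz⟩
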